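/- Work in a $\kappa$-saturated nonstandard universe for some uncountable cardinal $\kappa$; internal sets, hyperreals ${}^*\mathbb{R}$ and the internal number of elements $|A|\in{}^*\mathbb{N}$ of a hyperfinite set $A$ are understood in it. A set is monadic (galactic) if it is an intersection (a union) of fewer than $\kappa$ internal sets. Let $G$ be a hyperfinite abelian group, let $G_0\subseteq G$ be a monadic subgroup and $G_f\subseteq G$ a galactic subgroup with $G_0\subseteq G_f$, and assume that the triplet $(G,G_0,G_f)$ is condensing: every infinite hyperfinite set $H\subseteq G_f$ contains two distinct elements $x,y$ with $x-y\in G_0$. Let $\widehat G$ be the hyperfinite abelian group of all internal homomorphisms $\gamma:G\to{}^*\mathbb{T}$ and, for $A\subseteq G$, let $A^{\perp}=\{\gamma\in\widehat G:\gamma(a)\approx 1\text{ for all }a\in A\}$ be the infinitesimal annihilator of $A$. The dual triplet is $(\widehat G,G_f^{\perp},G_0^{\perp})$. A positive $d\in{}^*\mathbb{R}$ is called a normalizing multiplier for a condensing triplet $(G,G_0,G_f)$ if $d|A|$ is finite and not infinitesimal for every internal set $A$ with $G_0\subseteq A\subseteq G_f$. **Theorem 2.3.4 (Gordon's Conjecture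 2).** The dual triplet $(\widehat G,G_f^{\perp},G_0^{\perp})$ is again condensing (that is, $G_f^\perp\subseteq G_0^\perp$ are a monadic and a galactic subgroup of $\widehat G$ and the condition above holds), and: 1. for every internal set $D$ with $G_0\subseteq D\subseteq G_f$, $d=1/|D|$ is a normalizing multiplier for $(G,G_0,G_f)$ and $\hat d=|D|/|G|$ is a normalizing multiplier for the dual triplet $(\widehat G,G_f^{\perp},G_0^{\perp})$; 2. more generally, if $d$ is any normalizing multiplier for $(G,G_0,G_f)$, then $\hat d=(d|G|)^{-1}$ is a normalizing multiplier for the dual triplet $(\widehat G,G_f^{\perp},G_0^{\perp})$. -/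

import Mathlib

universe v

noncomputable section

/-- A nonstandard universe: every standard set `A` has a nonstandard extension `star A`, every
standard subset `P` of `A` has an extension `starSet P ⊆ star A`, and every standard function
`f : A → B` has an extension `map f : star A → star B`, in such a way that the *transfer principle*
holds.  Relations of several variables are subsets of products, and `pair` says that the elements of
`star (A × B)` are the pairs of elements of `star A` and `star B` (uniqueness of the pair follows
from `map_eq_map_iff`).  Thus Boolean combinations, equality and substitution of functions are
transferred by the fields below; quantifiers are then transferred too, because the standard universe
has Skolem functions.  So these fields say exactly that the standard universe, with all its
functions and relations, is elementarily embedded in the nonstandard one. -/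
structure NonstandardUniverse where
  star : Type → Type v
  starSet : {A : Type} → Set A → Set (star A)
  map : {A B : Type} → (A → B) → star A → star B
  nonempty_star_unit : Nonempty (star Unit)
  map_id : ∀ {A : Type} (a : star A), map id a = a
  map_comp : ∀ {A B C : Type} (g : B → C) (f : A → B) (a : star A),
    map (g ∘ f) a = map g (map f a)
  mem_compl : ∀ {A : Type} (P : Set A) (a : star A), a ∈ starSet Pᶜ ↔ a ∉ starSet P
  mem_inter : ∀ {A : Type} (P Q : Set A) (a : star A),
    a ∈ starSet (P ∩ Q) ↔ a ∈ starSet P ∧ a ∈ starSet Q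
  map_mem_iff : ∀ {A B : Type} (f : A → B) (P : Set B) (a : star A),
    map f a ∈ starSet P ↔ a ∈ starSet (f ⁻¹' P)
  map_eq_map_iff : ∀ {A B : Type} (f g : A → B) (a : star A),
    map f a = map g a ↔ a ∈ starSet {x | f x = g x}
  pair : ∀ {A B : Type} (a : star A) (b : star B),
    ∃ c : star (A × B), map Prod.fst c = a ∧ map Prod.snd c = b

namespace NonstandardUniverse

variable (U : NonstandardUniverse.{v})

theorem mem_mono {A : Type} {P Q : Set A} (h : P ⊆ Q) {a : U.star A} (ha : a ∈ U.starSet P) :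
    a ∈ U.starSet Q := by
  rw [← Set.inter_eq_left.mpr h, U.mem_inter] at ha
  exact ha.2

theorem not_mem_empty {A : Type} (a : U.star A) : a ∉ U.starSet (∅ : Set A) := by
  intro h
  have h2 : a ∈ U.starSet (∅ : Set A)ᶜ := U.mem_mono (Set.empty_subset _) h
  exact (U.mem_compl _ _).mp h2 h

theorem mem_univ {A : Type} (a : U.star A) : a ∈ U.starSet (Set.univ : Set A) := by
  rw [← Set.compl_empty, U.mem_compl]
  exact U.not_mem_empty a

theorem map_congr {A B : Type} {f g : A → B} (h : ∀ x, f x = g x) (a : U.star A) :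
    U.map f a = U.map g a := by
  rw [funext h]

theorem exists_subtype {A : Type} {P : Set A} {a : U.star A} (ha : a ∈ U.starSet P) :
    ∃ b : U.star P, U.map Subtype.val b = a := by
  classical
  by_cases hP : P.Nonempty
  · obtain ⟨p, hp⟩ := hP
    let r : A → P := fun x => if h : x ∈ P then ⟨x, h⟩ else ⟨p, hp⟩
    refine ⟨U.map r a, ?_⟩
    rw [← U.map_comp]
    conv_rhs => rw [← U.map_id a]
    rw [U.map_eq_map_iff]
    refine U.mem_mono (fun x hx => ?_) ha
    simp [r, hx]
  · rw [Set.not_nonempty_iff_eq_empty.mp hP] at ha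
    exact absurd ha (U.not_mem_empty a)

/-! ### Internal sets

An internal set is the member `F_ν` with index `ν ∈ star I` of the nonstandard extension of a
standard family of sets `(F i)_{i ∈ I}`. -/

/-- The internal set `F_ν` of index `ν` in the extension of the standard family `F`: its elements
are the elements of the extension of the disjoint union of the family that lie over `ν`. -/
def Fiber {I : Type} (F : I → Type) (ν : U.star I) : Type v :=
  {x : U.star (Σ i, F i) // U.map Sigma.fst x = ν}

variable {U}

namespace Fiber

variable {I : Type} {F F₁ F₂ F₃ : I → Type} {ν : U.star I}

/-- The internal function given by a standard family of functions. -/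
def map (f : ∀ i, F i → F₁ i) (x : U.Fiber F ν) : U.Fiber F₁ ν :=
  ⟨U.map (fun p => ⟨p.1, f p.1 p.2⟩) x.1, by
    rw [← U.map_comp]
    exact x.2⟩

/-- The internal element given by a standard family of elements. -/
def const (ν : U.star I) (c : ∀ i, F i) : U.Fiber F ν :=
  ⟨U.map (fun i => ⟨i, c i⟩) ν, by
    rw [← U.map_comp]
    exact U.map_id ν⟩

theorem map_map (g : ∀ i, F₁ i → F₂ i) (f : ∀ i, F i → F₁ i) (x : U.Fiber F ν) :
    map g (map f x) = map (fun i a => g i (f i a)) x := by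
  apply Subtype.ext
  exact (U.map_comp _ _ _).symm

theorem map_id (x : U.Fiber F ν) : map (fun _ a => a) x = x := by
  apply Subtype.ext
  exact U.map_id _

theorem map_const (c : ∀ i, F₁ i) (x : U.Fiber F ν) : map (fun i _ => c i) x = const ν c := by
  apply Subtype.ext
  obtain ⟨x, rfl⟩ := x
  simp only [map, const]
  rw [← U.map_comp]
  exact U.map_congr (fun _ => rfl) _

theorem exists_joint (x : U.Fiber F ν) (y : U.Fiber F₁ ν) :
    ∃ z : U.Fiber (fun i => F i × F₁ i) ν,
      map (fun _ p => p.1) z = x ∧ map (fun _ p => p.2) z = y := by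
  obtain ⟨c, hc₁, hc₂⟩ := U.pair x.1 y.1
  have hc : c ∈ U.starSet {p : (Σ i, F i) × (Σ i, F₁ i) | p.1.1 = p.2.1} := by
    rw [← U.map_eq_map_iff (fun p : (Σ i, F i) × (Σ i, F₁ i) => p.1.1) (fun p => p.2.1)]
    have h₁ := x.2
    have h₂ := y.2
    rw [← hc₁, ← U.map_comp] at h₁
    rw [← hc₂, ← U.map_comp] at h₂
    exact h₁.trans h₂.symm
  obtain ⟨b, rfl⟩ := U.exists_subtype hc
  let r : {p : (Σ i, F i) × (Σ i, F₁ i) | p.1.1 = p.2.1} → Σ i, F i × F₁ i :=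
    fun p => ⟨p.1.2.1, (p.2 : p.1.1.1 = p.1.2.1) ▸ p.1.1.2, p.1.2.2⟩
  have h₁ : ∀ p : {p : (Σ i, F i) × (Σ i, F₁ i) | p.1.1 = p.2.1},
      (⟨(r p).1, (r p).2.1⟩ : Σ i, F i) = p.1.1 := by
    rintro ⟨⟨⟨i, a⟩, ⟨j, b⟩⟩, h⟩
    obtain rfl : i = j := h
    rfl
  refine ⟨⟨U.map r b, ?_⟩, ?_, ?_⟩
  · rw [← U.map_comp, ← y.2, ← hc₂, ← U.map_comp, ← U.map_comp]
    rfl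
  · apply Subtype.ext
    refine Eq.trans ?_ hc₁
    simp only [map]
    rw [← U.map_comp, ← U.map_comp]
    exact U.map_congr h₁ _
  · apply Subtype.ext
    refine Eq.trans ?_ hc₂
    simp only [map]
    rw [← U.map_comp, ← U.map_comp]
    exact U.map_congr (fun p => rfl) _

theorem joint_unique {z w : U.Fiber (fun i => F i × F₁ i) ν}
    (h₁ : map (fun _ p => p.1) z = map (fun _ p => p.1) w)
    (h₂ : map (fun _ p => p.2) z = map (fun _ p => p.2) w) : z = w := by
  obtain ⟨c, hz, hw⟩ := U.pair z.1 w.1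
  have e₁ := congrArg Subtype.val h₁
  have e₂ := congrArg Subtype.val h₂
  simp only [map] at e₁ e₂
  rw [← hz, ← hw, ← U.map_comp, ← U.map_comp, U.map_eq_map_iff] at e₁ e₂
  apply Subtype.ext
  rw [← hz, ← hw, U.map_eq_map_iff]
  refine U.mem_mono ?_ ((U.mem_inter _ _ _).mpr ⟨e₁, e₂⟩)
  rintro ⟨⟨i, a, b⟩, ⟨j, a', b'⟩⟩ ⟨h, h'⟩
  simp only [Set.mem_ofPred_eq, Function.comp_apply, Sigma.mk.injEq] at h h'
  obtain ⟨rfl, h⟩ := h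
  obtain rfl := eq_of_heq h
  obtain rfl := eq_of_heq h'.2
  rfl

/-- The pair of two elements of internal sets of the same index. -/
def joint (x : U.Fiber F ν) (y : U.Fiber F₁ ν) : U.Fiber (fun i => F i × F₁ i) ν :=
  Classical.choose (exists_joint x y)

theorem fst_joint (x : U.Fiber F ν) (y : U.Fiber F₁ ν) :
    map (fun _ p => p.1) (joint x y) = x :=
  (Classical.choose_spec (exists_joint x y)).1

theorem snd_joint (x : U.Fiber F ν) (y : U.Fiber F₁ ν) :
    map (fun _ p => p.2) (joint x y) = y :=
  (Classical.choose_spec (exists_joint x y)).2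

theorem joint_map (f : ∀ i, F i → F₁ i) (g : ∀ i, F i → F₂ i) (z : U.Fiber F ν) :
    joint (map f z) (map g z) = map (fun i a => (f i a, g i a)) z := by
  apply joint_unique
  · rw [fst_joint, map_map]
  · rw [snd_joint, map_map]

/-- The internal function of two variables given by a standard family of such functions. -/
def map₂ (f : ∀ i, F i → F₁ i → F₂ i) (x : U.Fiber F ν) (y : U.Fiber F₁ ν) : U.Fiber F₂ ν :=
  map (fun i p => f i p.1 p.2) (joint x y)

theorem map₂_map (f : ∀ i, F₁ i → F₂ i → F₃ i) (g : ∀ i, F i → F₁ i) (h : ∀ i, F i → F₂ i)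
    (z : U.Fiber F ν) : map₂ f (map g z) (map h z) = map (fun i a => f i (g i a) (h i a)) z := by
  rw [map₂, joint_map, map_map]

theorem const_map₂ (f : ∀ i, F i → F₁ i → F₂ i) (c : ∀ i, F i) (x : U.Fiber F₁ ν) :
    map₂ f (const ν c) x = map (fun i a => f i (c i) a) x := by
  have h := map₂_map f (fun i _ => c i) (fun _ a => a) x
  rwa [map_const, map_id] at h

instance instAdd [∀ i, AddCommGroup (F i)] : Add (U.Fiber F ν) where
  add := map₂ (fun _ a b => a + b)

instance instZero [∀ i, AddCommGroup (F i)] : Zero (U.Fiber F ν) where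
  zero := const ν (fun _ => 0)

instance instNeg [∀ i, AddCommGroup (F i)] : Neg (U.Fiber F ν) where
  neg := map (fun _ a => -a)

theorem add_def [∀ i, AddCommGroup (F i)] (x y : U.Fiber F ν) :
    x + y = map₂ (fun _ a b => a + b) x y := rfl

theorem zero_def [∀ i, AddCommGroup (F i)] :
    (0 : U.Fiber F ν) = const ν (fun _ => 0) := rfl

theorem neg_def [∀ i, AddCommGroup (F i)] (x : U.Fiber F ν) :
    -x = map (fun _ a => -a) x := rfl

protected theorem add_comm_aux [∀ i, AddCommGroup (F i)] (x y : U.Fiber F ν) :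
    x + y = y + x := by
  obtain ⟨w, rfl, rfl⟩ := exists_joint x y
  simp only [add_def, map₂_map, add_comm]

protected theorem zero_add_aux [∀ i, AddCommGroup (F i)] (x : U.Fiber F ν) : 0 + x = x := by
  simp only [add_def, zero_def, const_map₂, zero_add, map_id]

/-- The internal operations of an internal abelian group satisfy the group laws. -/
instance instAddCommGroup [∀ i, AddCommGroup (F i)] : AddCommGroup (U.Fiber F ν) where
  add_assoc x y z := by
    obtain ⟨w, rfl, hw⟩ := exists_joint x (joint y z)
    have hy : y = map (fun _ p => p.2.1) w := by
      rw [← fst_joint y z, ← hw, map_map]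
    have hz : z = map (fun _ p => p.2.2) w := by
      rw [← snd_joint y z, ← hw, map_map]
    rw [hy, hz]
    simp only [add_def, map₂_map, add_assoc]
  zero_add := Fiber.zero_add_aux
  add_zero x := by rw [Fiber.add_comm_aux, Fiber.zero_add_aux]
  neg_add_cancel x := by
    have h := map₂_map (fun i (a b : F i) => a + b) (fun _ a => -a) (fun _ a => a) x
    rw [map_id] at h
    rw [add_def, neg_def, h, zero_def, ← map_const (F₁ := F) (fun _ => 0) x]
    simp only [neg_add_cancel]
  add_comm := Fiber.add_comm_aux
  nsmul := nsmulRec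
  zsmul := zsmulRec

end Fiber

/-- The internal subsets of the internal set `F_ν`: the elements of the internal power set. -/
abbrev InternalSet (U : NonstandardUniverse.{v}) {I : Type} (F : I → Type) (ν : U.star I) :
    Type v :=
  U.Fiber (fun i => Set (F i)) ν

namespace InternalSet

variable {I : Type} {F : I → Type} {ν : U.star I}

/-- The set of elements of an internal set. -/
def toSet (S : U.InternalSet F ν) : Set (U.Fiber F ν) :=
  {x | (Fiber.joint x S).1 ∈ U.starSet {p : Σ i, F i × Set (F i) | p.2.1 ∈ p.2.2}}

/-- The internal set is hyperfinite. -/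
def IsHyperfinite (S : U.InternalSet F ν) : Prop :=
  S.1 ∈ U.starSet {p : Σ i, Set (F i) | p.2.Finite}

/-- The internal number of elements of a hyperfinite set, as a hyperreal number. -/
def card (S : U.InternalSet F ν) : U.star ℝ :=
  U.map (fun p : Σ i, Set (F i) => (p.2.ncard : ℝ)) S.1

end InternalSet

/-- The internal number of elements of the hyperfinite set `F_ν`, as a hyperreal number. -/
def fiberCard {I : Type} (F : I → Type) (ν : U.star I) : U.star ℝ :=
  U.map (fun i => (Nat.card (F i) : ℝ)) ν

/-- The universe is `κ`-saturated: every system of fewer than `κ` internal subsets of an internal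
set which has the finite intersection property has nonempty intersection. -/
def IsSaturated (U : NonstandardUniverse.{v}) (κ : Cardinal.{v}) : Prop :=
  ∀ (I : Type) (F : I → Type) (ν : U.star I) (𝒮 : Set (Set (U.Fiber F ν))),
    Cardinal.mk 𝒮 < κ →
    (∀ S ∈ 𝒮, ∃ T : U.InternalSet F ν, T.toSet = S) →
    (∀ 𝒯 : Set (Set (U.Fiber F ν)), 𝒯 ⊆ 𝒮 → 𝒯.Finite → (⋂₀ 𝒯).Nonempty) →
    (⋂₀ 𝒮).Nonempty

/-! ### Hyperreal numbers -/

/-- The pair of two elements of nonstandard extensions. -/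
def mkPair {A B : Type} (a : U.star A) (b : U.star B) : U.star (A × B) :=
  Classical.choose (U.pair a b)

instance instMulStarReal : Mul (U.star ℝ) where
  mul x y := U.map (fun p : ℝ × ℝ => p.1 * p.2) (mkPair x y)

instance instInvStarReal : Inv (U.star ℝ) where
  inv x := U.map (fun r : ℝ => r⁻¹) x

/-- The hyperreal number is positive. -/
def IsPos (x : U.star ℝ) : Prop := x ∈ U.starSet {r : ℝ | 0 < r}

/-- The hyperreal number is finite, i.e. bounded by a standard real number. -/
def IsFinite (x : U.star ℝ) : Prop := ∃ M : ℝ, x ∈ U.starSet {r : ℝ | |r| ≤ M}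

/-- The hyperreal number is infinitesimal. -/
def IsInfinitesimal (x : U.star ℝ) : Prop := ∀ ε : ℝ, 0 < ε → x ∈ U.starSet {r : ℝ | |r| < ε}

/-- The element of the extension of the unit circle is infinitely near to `1`. -/
def IsNearOne (z : U.star Circle) : Prop :=
  ∀ ε : ℝ, 0 < ε → z ∈ U.starSet {w : Circle | ‖(w : ℂ) - 1‖ < ε}

/-! ### Group triplets and their duals -/

section Triplet

variable {I : Type} {G : I → Type} {ν : U.star I}

/-- A monadic set: an intersection of fewer than `κ` internal sets. -/
def IsMonadic (κ : Cardinal.{v}) (A : Set (U.Fiber G ν)) : Prop :=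
  ∃ 𝒬 : Set (Set (U.Fiber G ν)), Cardinal.mk 𝒬 < κ ∧
    (∀ Q ∈ 𝒬, ∃ T : U.InternalSet G ν, T.toSet = Q) ∧ A = ⋂₀ 𝒬

/-- A galactic set: a union of fewer than `κ` internal sets. -/
def IsGalactic (κ : Cardinal.{v}) (A : Set (U.Fiber G ν)) : Prop :=
  ∃ 𝒬 : Set (Set (U.Fiber G ν)), Cardinal.mk 𝒬 < κ ∧
    (∀ Q ∈ 𝒬, ∃ T : U.InternalSet G ν, T.toSet = Q) ∧ A = ⋃₀ 𝒬

variable [∀ i, AddCommGroup (G i)]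

/-- `(G_ν, G₀, Gf)` is an IMG group triplet: `G₀` is a monadic subgroup and `Gf` a galactic
subgroup of the internal abelian group `G_ν`, and `G₀ ⊆ Gf`. -/
structure IsIMGTriplet (κ : Cardinal.{v}) (G₀ Gf : AddSubgroup (U.Fiber G ν)) : Prop where
  le : G₀ ≤ Gf
  monadic : IsMonadic κ (G₀ : Set (U.Fiber G ν))
  galactic : IsGalactic κ (Gf : Set (U.Fiber G ν))

/-- A condensing IMG group triplet: every infinite hyperfinite subset of `Gf` contains two distinct
elements which are indiscernible, i.e. congruent modulo `G₀`. -/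
structure IsCondensingTriplet (κ : Cardinal.{v}) (G₀ Gf : AddSubgroup (U.Fiber G ν)) : Prop
    extends IsIMGTriplet κ G₀ Gf where
  condensing : ∀ H : U.InternalSet G ν, H.IsHyperfinite → H.toSet ⊆ Gf → H.toSet.Infinite →
    ∃ x ∈ H.toSet, ∃ y ∈ H.toSet, x ≠ y ∧ x - y ∈ G₀

/-- The internal set `A` lies between `G₀` and `Gf`. -/
def IsBetween (G₀ Gf : AddSubgroup (U.Fiber G ν)) (A : U.InternalSet G ν) : Prop :=
  (G₀ : Set (U.Fiber G ν)) ⊆ A.toSet ∧ A.toSet ⊆ Gf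

/-- The positive hyperreal number `d` is a normalizing multiplier for the triplet `(G_ν, G₀, Gf)`:
the product `d * |A|` is finite and not infinitesimal for every internal set `A` between `G₀` and
`Gf`. -/
def IsNormalizingMultiplier (G₀ Gf : AddSubgroup (U.Fiber G ν)) (d : U.star ℝ) : Prop :=
  IsPos d ∧ ∀ A : U.InternalSet G ν, IsBetween G₀ Gf A →
    IsFinite (d * A.card) ∧ ¬ IsInfinitesimal (d * A.card)

/-- The standard family of the dual groups `Hom(G i, 𝕋)`; its member of index `ν` is the group of
all internal characters of `G_ν`, with the pointwise operation (here written additively). -/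
abbrev DualFamily (G : I → Type) [∀ i, AddCommGroup (G i)] : I → Type :=
  fun i => AddChar (G i) Circle

/-- The value of an internal character. -/
def charApply (γ : U.Fiber (DualFamily G) ν) (a : U.Fiber G ν) : U.star Circle :=
  U.map (fun p : Σ i, AddChar (G i) Circle × G i => p.2.1 p.2.2) (Fiber.joint γ a).1

theorem charApply_add (γ χ : U.Fiber (DualFamily G) ν) (a : U.Fiber G ν) :
    ∃ c : U.star (Circle × Circle), U.map Prod.fst c = charApply γ a ∧
      U.map Prod.snd c = charApply χ a ∧
      U.map (fun p => p.1 * p.2) c = charApply (γ + χ) a := by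
  change ∃ c : U.star (Circle × Circle), U.map Prod.fst c = charApply γ a ∧
      U.map Prod.snd c = charApply χ a ∧
      U.map (fun p => p.1 * p.2) c = charApply (Fiber.map₂ (fun _ a b => a + b) γ χ) a
  obtain ⟨w, rfl, hw⟩ := Fiber.exists_joint γ (Fiber.joint χ a)
  have hχ : χ = Fiber.map (fun _ p => p.2.1) w := by
    rw [← Fiber.fst_joint χ a, ← hw, Fiber.map_map]
  have ha : a = Fiber.map (fun _ p => p.2.2) w := by
    rw [← Fiber.snd_joint χ a, ← hw, Fiber.map_map]
  rw [hχ, ha]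
  refine ⟨U.map (fun p => (p.2.1 p.2.2.2, p.2.2.1 p.2.2.2)) w.1, ?_, ?_, ?_⟩
  all_goals
    simp only [charApply, Fiber.map₂_map, Fiber.joint_map]
    simp only [Fiber.map]
    rw [← U.map_comp, ← U.map_comp]
    exact U.map_congr (fun p => rfl) _

theorem charApply_zero (a : U.Fiber G ν) :
    charApply (0 : U.Fiber (DualFamily G) ν) a = U.map (fun _ => 1) a.1 := by
  change charApply (Fiber.const (F := DualFamily G) ν (fun _ => 0)) a = _
  rw [← Fiber.map_const (F₁ := DualFamily G) (fun _ => 0) a, charApply]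
  conv_lhs => rw [← Fiber.map_id a]
  rw [Fiber.map_map, Fiber.joint_map, Fiber.map, ← U.map_comp]
  exact U.map_congr (fun p => rfl) _

theorem charApply_neg (γ : U.Fiber (DualFamily G) ν) (a : U.Fiber G ν) :
    charApply (-γ) a = U.map (fun z => z⁻¹) (charApply γ a) := by
  change charApply (Fiber.map (fun _ χ => -χ) γ) a = _
  obtain ⟨w, rfl, rfl⟩ := Fiber.exists_joint γ a
  simp only [charApply, Fiber.map_map, Fiber.joint_map]
  simp only [Fiber.map]
  rw [← U.map_comp, ← U.map_comp, ← U.map_comp]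
  exact U.map_congr (fun p => AddChar.neg_apply' _ _) _

/-- The infinitesimal annihilator of a set `A ⊆ G_ν`: the group of all internal characters `γ` of
`G_ν` such that `γ a` is infinitely near to `1` for all `a ∈ A`. -/
def infAnnihilator (A : Set (U.Fiber G ν)) : AddSubgroup (U.Fiber (DualFamily G) ν) where
  carrier := {γ | ∀ a ∈ A, IsNearOne (charApply γ a)}
  add_mem' := by
    intro γ χ hγ hχ a ha ε hε
    obtain ⟨c, h₁, h₂, h₃⟩ := charApply_add γ χ a
    have k₁ := hγ a ha (ε / 2) (half_pos hε)
    have k₂ := hχ a ha (ε / 2) (half_pos hε)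
    rw [← h₁, U.map_mem_iff] at k₁
    rw [← h₂, U.map_mem_iff] at k₂
    rw [← h₃, U.map_mem_iff]
    refine U.mem_mono ?_ ((U.mem_inter _ _ _).mpr ⟨k₁, k₂⟩)
    rintro ⟨z, w⟩ ⟨hz, hw⟩
    simp only [Set.mem_preimage, Set.mem_ofPred_eq] at hz hw ⊢
    have e : ((z * w : Circle) : ℂ) - 1 = (z : ℂ) * ((w : ℂ) - 1) + ((z : ℂ) - 1) := by
      rw [Circle.coe_mul]; ring
    rw [e]
    refine (norm_add_le _ _).trans_lt ?_
    rw [norm_mul, Circle.norm_coe, one_mul]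
    linarith
  zero_mem' := by
    intro a ha ε hε
    rw [charApply_zero, U.map_mem_iff]
    refine U.mem_mono ?_ (U.mem_univ _)
    intro x _
    simpa using hε
  neg_mem' := by
    intro γ hγ a ha ε hε
    have k := hγ a ha ε hε
    rw [charApply_neg, U.map_mem_iff]
    refine U.mem_mono ?_ k
    intro z hz
    simp only [Set.mem_preimage, Set.mem_ofPred_eq] at hz ⊢
    have e : ((z⁻¹ : Circle) : ℂ) - 1 = -(((z⁻¹ : Circle) : ℂ) * ((z : ℂ) - 1)) := by
      rw [mul_sub, ← Circle.coe_mul, inv_mul_cancel]; simp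
    rw [e, norm_neg, norm_mul, Circle.norm_coe, one_mul]
    exact hz

end Triplet

end NonstandardUniverse

end

/-!
The proof reduces the theorem to two counting statements about Bohr sets in finite abelian groups,
which are transferred to the hyperfinite group `G`.

Write `Bohr(A, ε)` for the set of characters that are `ε`-near to `1` on `A`. Parseval's identity
gives `|Bohr(B, 1/2)| |B| ≤ 4 |G|` for every `B` (`FiniteDual.ncard_bohr_mul_le`). Conversely,
`|G| ≤ C |Bohr(A, ε)| |A|` with `C` depending only on `ε` and `K`, if `0 ∈ A` and `A + A` is covered
by `K` translates of `A` (`FiniteDual.exists_ncard_bohr_lower_bound`). Indeed, the sumsets `m • A`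
then grow polynomially in `m`. Hence some `S = (m + 1) • A` with bounded `m` is almost invariant
under translation by the elements of `A`, so that the characters with a large Fourier coefficient on
`S` are `ε`-near to `1` on `A`; and there are many such characters, because by the Cauchy-Schwarz
inequality the polynomial growth keeps the high moments of the Fourier transform of the indicator
function of `S` large. The two bounds together limit the size of a set of characters which is
separated by `Bohr(A, ε)` and lies in `Bohr(B, 1/4)`, when `A` is covered by finitely many
translates of `B ⊆ A` (`FiniteDual.exists_ncard_separated_le`).

In a condensing triplet a maximal separated set is finite, so every internal subset of `Gf` is
covered by finitely many translates of every internal set that contains `G₀`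
(`IsCondensingTriplet.exists_coveredBy`). Thus internal sets between `G₀` and `Gf` have standard
doubling, and any two of them have comparable sizes. Saturation links internal sets of characters to
Bohr sets: an internal subset of `G₀^⊥` lies in some `Bohr(B, ε)`, and an internal set that contains
`Gf^⊥` contains some `Bohr(A, ε)`, with `A` and `B` between `G₀` and `Gf`
(`IsIMGTriplet.exists_subset_bohrSet`, `IsGalactic.exists_bohrSet_subset`). The counting statements
then bound `|E| |D| / |G|` from both sides for `D` between `G₀` and `Gf` and `E` between `Gf^⊥` and
`G₀^⊥`, and they show that a hyperfinite subset of `G₀^⊥` without two elements congruent modulo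
`Gf^⊥` is finite.
-/

noncomputable section

/-! ### Bohr sets in finite abelian groups -/

namespace FiniteDual

open Finset Pointwise

variable {G : Type*} [AddCommGroup G]

/-- The Bohr set of `A` with radius `ε`: the characters that are `ε`-near to `1` on `A`. -/
def bohr (A : Set G) (ε : ℝ) : Set (AddChar G Circle) :=
  {γ | ∀ a ∈ A, ‖(γ a : ℂ) - 1‖ < ε}

/-- `A` is covered by at most `n` translates of `B`; in `Set.ncard` infinite sets count as `0`,
hence the finiteness clause. -/
def CoveredBy (n : ℕ) (A B : Set G) : Prop :=
  ∃ X : Set G, X.Finite ∧ X.ncard ≤ n ∧ ∀ a ∈ A, ∃ x ∈ X, a - x ∈ B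

theorem CoveredBy.ncard_le [Finite G] {n : ℕ} {A B : Set G} (h : CoveredBy n A B) :
    A.ncard ≤ n * B.ncard := by
  classical
  obtain ⟨X, -, hX, hA⟩ := h
  have hsub : A ⊆ (fun p : G × G => p.1 + p.2) '' (X ×ˢ B) := by
    intro a ha
    obtain ⟨x, hx, hb⟩ := hA a ha
    exact ⟨(x, a - x), ⟨hx, hb⟩, by simp⟩
  calc A.ncard ≤ ((fun p : G × G => p.1 + p.2) '' (X ×ˢ B)).ncard :=
        Set.ncard_le_ncard hsub (Set.toFinite _)
    _ ≤ (X ×ˢ B).ncard := Set.ncard_image_le (Set.toFinite _)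
    _ = X.ncard * B.ncard := Set.ncard_prod
    _ ≤ n * B.ncard := Nat.mul_le_mul_right _ hX

/-- A maximal separated subset of `A` gives a covering of `A` by translates of `B`. -/
theorem exists_separated_cover [Finite G] (A B : Set G) (hB : (0 : G) ∈ B) :
    ∃ H : Set G, H ⊆ A ∧ (∀ x ∈ H, ∀ y ∈ H, x ≠ y → x - y ∈ B → y - x ∉ B) ∧
      ∀ a ∈ A, ∃ h ∈ H, a - h ∈ B := by
  obtain ⟨H, hH⟩ := (Set.toFinite {H : Set G | H ⊆ A ∧
    ∀ x ∈ H, ∀ y ∈ H, x ≠ y → x - y ∈ B → y - x ∉ B}).exists_maximal ⟨∅, by simp⟩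
  refine ⟨H, hH.prop.1, hH.prop.2, fun a ha => ?_⟩
  by_contra! hcon
  have haH : a ∉ H := fun h => hcon a h (by simpa using hB)
  refine haH (hH.le_of_ge ⟨Set.insert_subset ha hH.prop.1, ?_⟩ (Set.subset_insert a H)
    (Set.mem_insert a H))
  rintro x (rfl | hx) y (rfl | hy) hxy h1 h2
  · exact hxy rfl
  · exact hcon y hy h1
  · exact hcon x hx h2
  · exact hH.prop.2 x hx y hy hxy h1 h2

/-! ### Polynomial growth of sumsets -/

section Growth

variable [DecidableEq G]

/-- If `A + A ⊆ A + X`, then every sum of `k + 1` elements of `A` differs from an element of `A` by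
a combination of the elements of `X` with coefficients at most `k`. -/
theorem mem_succ_nsmul {A X : Finset G} (h : A + A ⊆ A + X) (k : ℕ) {y : G}
    (hy : y ∈ (k + 1) • A) :
    ∃ a ∈ A, ∃ c : X → ℕ, (∀ x, c x ≤ k) ∧ y = a + ∑ x, c x • (x : G) := by
  induction k generalizing y with
  | zero => exact ⟨y, by simpa using hy, 0, by simp⟩
  | succ k ih =>
    rw [succ_nsmul, mem_add] at hy
    obtain ⟨z, hz, b, hb, rfl⟩ := hy
    obtain ⟨a, ha, c, hc, rfl⟩ := ih hz
    obtain ⟨a', ha', x, hx, hax⟩ := mem_add.mp (h (add_mem_add ha hb))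
    refine ⟨a', ha', c + Pi.single ⟨x, hx⟩ 1, fun t => ?_, ?_⟩
    · have : (Pi.single (⟨x, hx⟩ : X) (1 : ℕ) : X → ℕ) t ≤ 1 := by
        rw [Pi.single_apply]; split_ifs <;> simp
      simpa using add_le_add (hc t) this
    · have : ∑ t : X, (Pi.single (⟨x, hx⟩ : X) (1 : ℕ) : X → ℕ) t • (t : G) = x := by
        simp [Pi.single_apply, ite_smul]
      simp only [Pi.add_apply, add_smul, sum_add_distrib, this]
      calc _ = (a + b) + ∑ t : X, c t • (t : G) := by abel
        _ = _ := by rw [← hax]; abel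

theorem card_succ_nsmul_le {A X : Finset G} (h : A + A ⊆ A + X) (k : ℕ) :
    #((k + 1) • A) ≤ (k + 1) ^ #X * #A := by
  classical
  have hsub : (k + 1) • A ⊆ (A ×ˢ Fintype.piFinset fun _ : X => range (k + 1)).image
      (fun p : G × (X → ℕ) => p.1 + ∑ x, p.2 x • (x : G)) := by
    intro y hy
    obtain ⟨a, ha, c, hc, rfl⟩ := mem_succ_nsmul h k hy
    exact mem_image.mpr ⟨(a, c), by simpa [ha, Nat.lt_succ_iff] using hc, rfl⟩
  refine (card_le_card hsub).trans (card_image_le.trans ?_)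
  simp [card_product, mul_comm]

/-- A polynomially growing sequence of sumsets has a small growth ratio at some bounded place. -/
theorem exists_small_growth (K : ℕ) {η : ℝ} (hη : 0 < η) :
    ∃ M : ℕ, ∀ {G : Type*} [AddCommGroup G] [DecidableEq G] (A X : Finset G),
      A.Nonempty → A + A ⊆ A + X → #X ≤ K →
      ∃ m ≤ M, (#((m + 2) • A) : ℝ) ≤ (1 + η) * #((m + 1) • A) := by
  have hlim := tendsto_pow_const_div_const_pow_of_one_lt K (r := 1 + η) (by linarith)
  have hpos : (0 : ℝ) < 1 / (1 + η) := by positivity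
  obtain ⟨M, hM, hM1⟩ := ((hlim.eventually_lt_const hpos).and
    (Filter.eventually_ge_atTop 1)).exists
  obtain ⟨M, rfl⟩ := Nat.exists_eq_succ_of_ne_zero (Nat.one_le_iff_ne_zero.mp hM1)
  refine ⟨M, fun A X hA hAX hX => ?_⟩
  by_contra! hcon
  -- otherwise the sumsets grow exponentially up to the place `M`
  have hgrow : ∀ m ≤ M, (1 + η) ^ m * #A ≤ #((m + 1) • A) := by
    intro m
    induction m with
    | zero => intro _; simp
    | succ m ih =>
      intro hm
      have h1 := hcon m (by omega)
      have h2 := ih (by omega)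
      rw [pow_succ]
      nlinarith
  have h1 := hgrow M le_rfl
  have h2 : (#((M + 1) • A) : ℝ) ≤ ((M + 1 : ℕ) : ℝ) ^ K * #A := by
    have := (card_succ_nsmul_le hAX M).trans
      (Nat.mul_le_mul_right _ (Nat.pow_le_pow_right (Nat.succ_pos M) hX))
    exact_mod_cast this
  have h3 : (0 : ℝ) < #A := by exact_mod_cast hA.card_pos
  have h4 : (1 + η) ^ M ≤ ((M + 1 : ℕ) : ℝ) ^ K := le_of_mul_le_mul_right (h1.trans h2) h3
  rw [div_lt_div_iff₀ (by positivity) (by positivity), pow_succ, one_mul] at hM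
  have h5 : (0 : ℝ) < 1 + η := by linarith
  have := mul_le_mul_of_nonneg_right h4 h5.le
  simp only [Nat.succ_eq_add_one] at hM
  linarith

end Growth

/-! ### Fourier analysis on a finite abelian group -/

section Fourier

/-- The indicator function of a finite set. -/
def indic (S : Finset G) (x : G) : ℝ := by
  classical exact if x ∈ S then 1 else 0

/-- The convolution power: `convPow S k x` counts the representations of `x` as a sum of `k`
elements of `S`. -/
def convPow (S : Finset G) : ℕ → G → ℝ
  | 0 => indic {0}
  | k + 1 => fun x => ∑ s ∈ S, convPow S k (x - s)

theorem convPow_eq_zero [DecidableEq G] (S : Finset G) (k : ℕ) {x : G} (hx : x ∉ k • S) :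
    convPow S k x = 0 := by
  induction k generalizing x with
  | zero => simpa [convPow, indic] using hx
  | succ k ih =>
    refine sum_eq_zero fun s hs => ih fun h => hx ?_
    rw [succ_nsmul]
    simpa using add_mem_add h hs

theorem norm_sum_char_le (S : Finset G) (γ : AddChar G Circle) :
    ‖∑ s ∈ S, (γ s : ℂ)‖ ≤ #S := by
  simpa using norm_sum_le_of_le S fun s _ => (Circle.norm_coe (γ s)).le

/-- If `S` is almost invariant under translation by `x`, then a character with a large Fourier
coefficient on `S` is near to `1` at `x`. -/
theorem norm_sub_one_le_of_spectrum [DecidableEq G] (S : Finset G) (hS : S.Nonempty) {η : ℝ} {x : G}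
    (hx : (#(S ∪ S.image (· + x)) : ℝ) ≤ (1 + η) * #S) {γ : AddChar G Circle}
    (hγ : (#S : ℝ) ≤ 2 * ‖∑ s ∈ S, (γ s : ℂ)‖) : ‖(γ x : ℂ) - 1‖ ≤ 4 * η := by
  set S' := S.image (· + x) with hS'
  have hcard : #S' = #S := card_image_of_injective _ (add_left_injective x)
  have hs : (0 : ℝ) < #S := by exact_mod_cast hS.card_pos
  have hmul : (γ x : ℂ) * ∑ s ∈ S, (γ s : ℂ) = ∑ s ∈ S', (γ s : ℂ) := by
    rw [hS', sum_image (add_left_injective x).injOn, mul_sum]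
    refine sum_congr rfl fun s _ => ?_
    rw [AddChar.map_add_eq_mul, Circle.coe_mul, mul_comm]
  -- `(γ x - 1) Ŝ(γ)` is a sum over the symmetric difference of `S` and its translate only
  have hdiff : ((γ x : ℂ) - 1) * ∑ s ∈ S, (γ s : ℂ) =
      ∑ s ∈ S' \ S, (γ s : ℂ) - ∑ s ∈ S \ S', (γ s : ℂ) := by
    rw [sub_mul, hmul, one_mul, sum_sdiff_sub_sum_sdiff]
  have h1 : (#(S' \ S) : ℝ) ≤ η * #S := by
    have : #(S' \ S) + #S = #(S ∪ S') := by rw [union_comm]; exact card_sdiff_add_card S' S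
    have : (#(S' \ S) : ℝ) + #S = #(S ∪ S') := by exact_mod_cast this
    linarith
  have h2 : (#(S \ S') : ℝ) ≤ η * #S := by
    have : #(S \ S') + #S' = #(S ∪ S') := card_sdiff_add_card S S'
    rw [hcard] at this
    have : (#(S \ S') : ℝ) + #S = #(S ∪ S') := by exact_mod_cast this
    linarith
  have h3 : ‖(γ x : ℂ) - 1‖ * ‖∑ s ∈ S, (γ s : ℂ)‖ ≤ 2 * η * #S := by
    rw [← norm_mul, hdiff]
    refine (norm_sub_le _ _).trans ?_
    have := norm_sum_char_le (S' \ S) γ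
    have := norm_sum_char_le (S \ S') γ
    linarith
  have h4 := mul_le_mul_of_nonneg_left hγ (norm_nonneg ((γ x : ℂ) - 1))
  have h5 : ‖(γ x : ℂ) - 1‖ * #S ≤ 4 * η * #S := by nlinarith
  exact le_of_mul_le_mul_right h5 hs

instance [Finite G] : Finite (AddChar G Circle) :=
  Finite.of_equiv _ AddChar.circleEquivComplex.symm.toEquiv

variable [Fintype G]

/-- The Fourier transform of a real function, without normalization. -/
def fourier (f : G → ℝ) (γ : AddChar G Circle) : ℂ := ∑ x, (f x : ℂ) * γ x

theorem fourier_indic (S : Finset G) (γ : AddChar G Circle) :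
    fourier (indic S) γ = ∑ s ∈ S, (γ s : ℂ) := by
  classical
  simp [fourier, indic, apply_ite, ite_mul]

theorem fourier_convPow (S : Finset G) (k : ℕ) (γ : AddChar G Circle) :
    fourier (convPow S k) γ = (∑ s ∈ S, (γ s : ℂ)) ^ k := by
  induction k with
  | zero => simp [convPow, fourier_indic]
  | succ k ih =>
    have h : ∀ s : G, ∑ x, (convPow S k (x - s) : ℂ) * γ x = γ s * fourier (convPow S k) γ := by
      intro s
      rw [← Equiv.sum_comp (Equiv.addRight s), fourier, mul_sum]
      refine sum_congr rfl fun x _ => ?_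
      simp only [Equiv.coe_addRight, add_sub_cancel_right, AddChar.map_add_eq_mul, Circle.coe_mul]
      ring
    simp only [fourier, convPow, Complex.ofReal_sum, sum_mul]
    rw [sum_comm]
    simp only [h, ih, ← sum_mul]
    ring

theorem sum_convPow (S : Finset G) (k : ℕ) : ∑ x, convPow S k x = (#S : ℝ) ^ k := by
  have h := fourier_convPow S k 0
  simp only [fourier, AddChar.zero_apply, Circle.coe_one, mul_one, sum_const, nsmul_eq_mul] at h
  exact_mod_cast h

variable [Fintype (AddChar G Circle)]

theorem sum_char_apply [DecidableEq G] (a : G) :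
    ∑ γ : AddChar G Circle, (γ a : ℂ) = if a = 0 then (Fintype.card G : ℂ) else 0 := by
  rw [← AddChar.sum_apply_eq_ite, ← AddChar.circleEquivComplex.toEquiv.sum_comp]
  rfl

theorem parseval (f : G → ℝ) :
    ∑ γ : AddChar G Circle, ‖fourier f γ‖ ^ 2 = Fintype.card G * ∑ x, f x ^ 2 := by
  classical
  have key : ∀ γ : AddChar G Circle, ((‖fourier f γ‖ ^ 2 : ℝ) : ℂ) =
      ∑ x, ∑ y, (f x : ℂ) * f y * γ (x - y) := by
    intro γ
    rw [← Complex.normSq_eq_norm_sq, ← Complex.mul_conj, fourier, map_sum, sum_mul_sum]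
    refine sum_congr rfl fun x _ => sum_congr rfl fun y _ => ?_
    rw [map_mul, Complex.conj_ofReal, AddChar.map_sub_eq_div, Circle.coe_div, div_eq_mul_inv,
      ← Circle.coe_inv, Circle.coe_inv_eq_conj]
    ring
  have : ((∑ γ : AddChar G Circle, ‖fourier f γ‖ ^ 2 : ℝ) : ℂ) =
      ((Fintype.card G * ∑ x, f x ^ 2 : ℝ) : ℂ) := by
    rw [Complex.ofReal_sum]
    simp only [key]
    rw [sum_comm]
    push_cast
    rw [mul_sum]
    refine sum_congr rfl fun x _ => ?_
    rw [sum_comm]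
    simp only [← mul_sum, sum_char_apply, sub_eq_zero]
    simp
    ring
  exact_mod_cast this

/-- The `2k`-th moment of the Fourier transform of `S` is bounded below, by the Cauchy-Schwarz
inequality, in terms of the `k`-fold sumset. -/
theorem moment_lower_bound [DecidableEq G] (S : Finset G) (k : ℕ) :
    Fintype.card G * (#S : ℝ) ^ (2 * k) ≤
      #(k • S) * ∑ γ : AddChar G Circle, ‖∑ s ∈ S, (γ s : ℂ)‖ ^ (2 * k) := by
  have h1 : (#S : ℝ) ^ (2 * k) ≤ #(k • S) * ∑ x, convPow S k x ^ 2 := by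
    have h2 : ∑ x, convPow S k x = ∑ x ∈ k • S, convPow S k x :=
      (sum_subset (subset_univ _) fun x _ hx => convPow_eq_zero S k hx).symm
    rw [mul_comm, pow_mul, ← sum_convPow, h2]
    refine sq_sum_le_card_mul_sum_sq.trans ?_
    gcongr
    exact subset_univ _
  have h3 := parseval (convPow S k)
  simp only [fourier_convPow, norm_pow, ← pow_mul, mul_comm k 2] at h3
  rw [h3]
  calc _ ≤ (Fintype.card G : ℝ) * (#(k • S) * ∑ x, convPow S k x ^ 2) := by gcongr
    _ = _ := by ring

theorem sum_norm_sq (S : Finset G) :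
    ∑ γ : AddChar G Circle, ‖∑ s ∈ S, (γ s : ℂ)‖ ^ 2 = Fintype.card G * #S := by
  classical
  have h := parseval (indic S)
  simp only [fourier_indic] at h
  rw [h]
  simp [indic]

/-- The large spectrum of a set with few `k`-fold sums is large. -/
theorem card_spectrum_lower_bound [DecidableEq G] (S : Finset G) (hS : S.Nonempty) (k : ℕ) {L : ℝ}
    (hk : (#((k + 1) • S) : ℝ) ≤ L * #S) (hL : 2 * L ≤ 4 ^ k) :
    (Fintype.card G : ℝ) ≤ 2 * L * #S *
      #{γ : AddChar G Circle | (#S : ℝ) ≤ 2 * ‖∑ s ∈ S, (γ s : ℂ)‖} := by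
  set T : Finset (AddChar G Circle) := {γ | (#S : ℝ) ≤ 2 * ‖∑ s ∈ S, (γ s : ℂ)‖} with hT
  have hs : (0 : ℝ) < #S := by exact_mod_cast hS.card_pos
  set s : ℝ := ((#S : ℕ) : ℝ) with hsdef
  have hL0 : 0 < L := by
    have : (0 : ℝ) < #((k + 1) • S) := by exact_mod_cast (hS.nsmul).card_pos
    exact pos_of_mul_pos_left (this.trans_le hk) hs.le
  have hm := moment_lower_bound S (k + 1)
  rw [← hsdef] at hm
  -- outside the spectrum the moment of order `2 (k + 1)` is at most `(s / 2) ^ (2 k)` times the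
  -- second moment
  have hpt : ∀ γ : AddChar G Circle, ‖∑ s ∈ S, (γ s : ℂ)‖ ^ (2 * (k + 1)) ≤
      (if γ ∈ T then s ^ (2 * (k + 1)) else 0) +
        (s ^ 2 / 4) ^ k * ‖∑ s ∈ S, (γ s : ℂ)‖ ^ 2 := by
    intro γ
    have hn := norm_sum_char_le S γ
    rw [← hsdef] at hn
    split_ifs with hγ
    · have : ‖∑ s ∈ S, (γ s : ℂ)‖ ^ (2 * (k + 1)) ≤ s ^ (2 * (k + 1)) := by gcongr
      have h2 : 0 ≤ (s ^ 2 / 4) ^ k * ‖∑ s ∈ S, (γ s : ℂ)‖ ^ 2 := by positivity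
      linarith
    · have hlt : 2 * ‖∑ s ∈ S, (γ s : ℂ)‖ < s := by simpa [hT] using hγ
      rw [zero_add, pow_mul, pow_succ]
      gcongr
      nlinarith [norm_nonneg (∑ s ∈ S, (γ s : ℂ))]
  have hsum : ∑ γ : AddChar G Circle, ‖∑ s ∈ S, (γ s : ℂ)‖ ^ (2 * (k + 1)) ≤
      #T * s ^ (2 * (k + 1)) + (s ^ 2 / 4) ^ k * (Fintype.card G * s) := by
    refine (sum_le_sum fun γ _ => hpt γ).trans ?_
    rw [sum_add_distrib, ← mul_sum, sum_norm_sq, ← hsdef]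
    simp
  have hp : (0 : ℝ) < s ^ (2 * (k + 1)) := by positivity
  have e : (s ^ 2 / 4) ^ k * (Fintype.card G * s) * (2 * (L * s)) =
      (2 * L / 4 ^ k) * (Fintype.card G * s ^ (2 * (k + 1))) := by
    rw [div_pow, ← pow_mul]; ring
  have hq : 2 * L / 4 ^ k ≤ 1 := by rw [div_le_one (by positivity)]; exact hL
  have hNN : (0 : ℝ) ≤ Fintype.card G * s ^ (2 * (k + 1)) := by positivity
  have h1 : Fintype.card G * s ^ (2 * (k + 1)) ≤
      (L * s) * (#T * s ^ (2 * (k + 1)) + (s ^ 2 / 4) ^ k * (Fintype.card G * s)) := by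
    refine hm.trans ?_
    gcongr
  have h2 := mul_le_mul_of_nonneg_right hq hNN
  rw [← e] at h2
  have h3 : Fintype.card G * s ^ (2 * (k + 1)) ≤ (2 * L * s * #T) * s ^ (2 * (k + 1)) := by
    nlinarith
  exact le_of_mul_le_mul_right h3 hp

end Fourier

/-! ### Size of Bohr sets -/

/-- A Bohr set of radius `1 / 2` over `B` has at most `4 |G| / |B|` elements. -/
theorem ncard_bohr_mul_le [Finite G] (B : Set G) :
    ((bohr B (1 / 2)).ncard : ℝ) * B.ncard ≤ 4 * Nat.card G := by
  classical
  have := Fintype.ofFinite G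
  have := Fintype.ofFinite (AddChar G Circle)
  rw [Set.ncard_eq_toFinset_card', Set.ncard_eq_toFinset_card' B, Nat.card_eq_fintype_card]
  set S := B.toFinset
  rcases S.eq_empty_or_nonempty with h0 | hS
  · simp [h0]
  have hs : (0 : ℝ) < #S := by exact_mod_cast hS.card_pos
  -- the Fourier coefficients of `B` at the characters of the Bohr set are at least `|B| / 2`
  have hb : ∀ γ ∈ (bohr B (1 / 2)).toFinset, (#S : ℝ) ^ 2 / 4 ≤ ‖∑ s ∈ S, (γ s : ℂ)‖ ^ 2 := by
    intro γ hγ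
    have hγ' : γ ∈ bohr B (1 / 2) := by simpa using hγ
    have h1 : ‖∑ s ∈ S, ((γ s : ℂ) - 1)‖ ≤ ∑ s ∈ S, (1 / 2 : ℝ) :=
      norm_sum_le_of_le _ fun s hs => (hγ' s (by simpa [S] using hs)).le
    rw [sum_sub_distrib, sum_const, sum_const, nsmul_eq_mul, nsmul_eq_mul, mul_one] at h1
    have h2 : (#S : ℝ) ≤ ‖∑ s ∈ S, (γ s : ℂ)‖ + ‖∑ s ∈ S, (γ s : ℂ) - #S‖ := by
      have := norm_sub_le (∑ s ∈ S, (γ s : ℂ)) (∑ s ∈ S, (γ s : ℂ) - #S)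
      simpa using this
    have h3 : (#S : ℝ) / 2 ≤ ‖∑ s ∈ S, (γ s : ℂ)‖ := by linarith
    nlinarith
  have h1 : (#(bohr B (1 / 2)).toFinset : ℝ) * ((#S : ℝ) ^ 2 / 4) ≤ Fintype.card G * #S := by
    rw [← sum_norm_sq, ← nsmul_eq_mul]
    refine (card_nsmul_le_sum _ _ _ hb).trans ?_
    exact sum_le_univ_sum_of_nonneg fun γ => by positivity
  nlinarith

/-- A Bohr set over a set `A` of small doubling has, up to a constant, at least `|G| / |A|`
elements. -/
theorem exists_ncard_bohr_lower_bound (K : ℕ) {ε : ℝ} (hε : 0 < ε) :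
    ∃ C : ℝ, 0 < C ∧ ∀ {G : Type*} [AddCommGroup G] [Finite G] (A : Set G), 0 ∈ A →
      CoveredBy K {x | ∃ a ∈ A, ∃ b ∈ A, a + b = x} A →
      (Nat.card G : ℝ) ≤ C * ((bohr A ε).ncard * A.ncard) := by
  obtain ⟨M, hM⟩ := exists_small_growth K (η := ε / 5) (by positivity)
  -- exponential decay outside the spectrum beats the polynomial growth of the sumsets
  have hlim := tendsto_pow_const_div_const_pow_of_one_lt K (r := (4 : ℝ)) (by norm_num)
  have hpos : (0 : ℝ) < 1 / (2 * 4 * (M + 1) ^ K) := by positivity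
  obtain ⟨k, hk, hk1⟩ := ((hlim.eventually_lt_const hpos).and
    (Filter.eventually_ge_atTop 1)).exists
  obtain ⟨k, rfl⟩ := Nat.exists_eq_succ_of_ne_zero (Nat.one_le_iff_ne_zero.mp hk1)
  -- `L` bounds the growth from `S` to `(k + 1) • S`, for `S = (m + 1) • A` with `m ≤ M`
  set L : ℝ := (((k + 1) * (M + 1) : ℕ) : ℝ) ^ K with hL
  have hL0 : 0 < L := by positivity
  refine ⟨2 * L * L, by positivity, fun A h0 hcov => ?_⟩
  classical
  rename_i G _ _
  have := Fintype.ofFinite G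
  have := Fintype.ofFinite (AddChar G Circle)
  obtain ⟨X, -, hX, hcov⟩ := hcov
  have hAX : A.toFinset + A.toFinset ⊆ A.toFinset + X.toFinset := by
    intro y hy
    obtain ⟨a, ha, b, hb, rfl⟩ := mem_add.mp hy
    obtain ⟨x, hx, hax⟩ := hcov (a + b) ⟨a, by simpa using ha, b, by simpa using hb, rfl⟩
    exact mem_add.mpr ⟨a + b - x, by simpa using hax, x, by simpa using hx, by simp⟩
  rw [Set.ncard_eq_toFinset_card'] at hX
  have hA : A.toFinset.Nonempty := ⟨0, by simpa using h0⟩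
  obtain ⟨m, hm, hgr⟩ := hM A.toFinset X.toFinset hA hAX hX
  rw [Set.ncard_eq_toFinset_card', Set.ncard_eq_toFinset_card' A, Nat.card_eq_fintype_card]
  set F := A.toFinset
  set S := (m + 1) • F with hSdef
  have hF0 : (0 : G) ∈ F := by simpa [F] using h0
  have hS : S.Nonempty := hA.nsmul
  have hgrow : ∀ n : ℕ, n + 1 ≤ (k + 1) * (M + 1) → (#((n + 1) • F) : ℝ) ≤ L * #F := by
    intro n hn
    have h1 : #((n + 1) • F) ≤ ((k + 1) * (M + 1)) ^ K * #F := by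
      refine (card_succ_nsmul_le hAX n).trans (Nat.mul_le_mul_right _ ?_)
      exact (Nat.pow_le_pow_right n.succ_pos hX).trans (Nat.pow_le_pow_left hn K)
    rw [hL]
    exact_mod_cast h1
  have hFS : #F ≤ #S := card_le_card fun y hy => by
    rw [hSdef, succ_nsmul]
    have h0m : (0 : G) ∈ m • F := by
      simpa using nsmul_mem_nsmul (n := m) hF0
    simpa using add_mem_add h0m hy
  have hSL : (#S : ℝ) ≤ L * #F := hgrow m (by nlinarith)
  have hkS : (#((k + 1) • S) : ℝ) ≤ L * #S := by
    have e : (k + 1) • S = (((k + 1) * (m + 1) - 1) + 1) • F := by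
      rw [hSdef, ← mul_nsmul', Nat.sub_add_cancel (by nlinarith)]
    rw [e]
    refine (hgrow _ ?_).trans ?_
    · rw [Nat.sub_add_cancel (by nlinarith)]
      gcongr
    · gcongr
  have hL4 : 2 * L ≤ 4 ^ k := by
    rw [div_lt_div_iff₀ (by positivity) (by positivity), pow_succ] at hk
    rw [hL]
    push_cast at hk ⊢
    rw [mul_pow]
    nlinarith
  have hspec := card_spectrum_lower_bound S hS k hkS hL4
  have hle : #{γ : AddChar G Circle | (#S : ℝ) ≤ 2 * ‖∑ s ∈ S, (γ s : ℂ)‖} ≤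
      #(bohr A ε).toFinset := by
    refine card_le_card fun γ hγ => ?_
    rw [mem_filter] at hγ
    rw [Set.mem_toFinset]
    intro x hx
    refine (norm_sub_one_le_of_spectrum S hS (η := ε / 5) ?_ hγ.2).trans_lt (by linarith)
    refine le_trans ?_ hgr
    have : S ∪ S.image (· + x) ⊆ (m + 2) • F := by
      rw [show m + 2 = m + 1 + 1 from rfl, succ_nsmul, ← hSdef]
      intro y hy
      rcases mem_union.mp hy with hy | hy
      · simpa using add_mem_add hy hF0
      · obtain ⟨s, hs, rfl⟩ := mem_image.mp hy
        exact add_mem_add hs (by simpa [F] using hx)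
    exact_mod_cast card_le_card this
  have hle' : (#{γ : AddChar G Circle | (#S : ℝ) ≤ 2 * ‖∑ s ∈ S, (γ s : ℂ)‖} : ℝ) ≤
      #(bohr A ε).toFinset := by exact_mod_cast hle
  calc (Fintype.card G : ℝ) ≤ _ := hspec
    _ ≤ 2 * L * (L * #F) * #(bohr A ε).toFinset := by gcongr
    _ = _ := by ring

/-- A separated set of characters that are near to `1` on a set `B` comparable with `A` has bounded
size: the Bohr sets around its points are disjoint and lie in a Bohr set over `B`. -/
theorem exists_ncard_separated_le (K L : ℕ) {ε : ℝ} (hε : 0 < ε) :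
    ∃ N : ℕ, ∀ {G : Type*} [AddCommGroup G] [Finite G] (A B : Set G) (H : Set (AddChar G Circle)),
      0 ∈ A → B ⊆ A → CoveredBy K {x | ∃ a ∈ A, ∃ b ∈ A, a + b = x} A → CoveredBy L A B →
      H ⊆ bohr B (1 / 4) → (∀ x ∈ H, ∀ y ∈ H, x ≠ y → x - y ∉ bohr A ε) → H.ncard ≤ N := by
  -- `δ ≤ ε / 2` makes the translates of `bohr A δ` disjoint, and `δ ≤ 1 / 4` puts them into
  -- `bohr B (1 / 2)`
  set δ : ℝ := min (ε / 2) (1 / 4) with hδ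
  have hδ0 : 0 < δ := by positivity
  obtain ⟨C, hC0, hC⟩ := exists_ncard_bohr_lower_bound K hδ0
  refine ⟨⌊4 * C * L⌋₊, fun A B H h0 hBA hK hL hH hsep => Nat.le_floor ?_⟩
  rename_i G _ _
  have hlow := hC A h0 hK
  have hAB : (A.ncard : ℝ) ≤ L * B.ncard := by exact_mod_cast hL.ncard_le
  have hup := ncard_bohr_mul_le B
  have hnear : ∀ (z w : Circle), ‖((z / w : Circle) : ℂ) - 1‖ = ‖(z : ℂ) - w‖ := by
    intro z w
    have : ((z / w : Circle) : ℂ) - 1 = ((z : ℂ) - w) / w := by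
      rw [Circle.coe_div, sub_div, div_self w.coe_ne_zero]
    rw [this, norm_div, Circle.norm_coe, div_one]
  have hinj : Set.InjOn (fun p : AddChar G Circle × AddChar G Circle => p.1 + p.2)
      (H ×ˢ bohr A δ) := by
    rintro ⟨x, φ⟩ ⟨hx, hφ⟩ ⟨y, ψ⟩ ⟨hy, hψ⟩ h
    simp only at h hx hφ hy hψ
    have hxy : x = y := by
      by_contra hne
      refine hsep x hx y hy hne fun a ha => ?_
      have e : x - y = ψ - φ := by
        rw [sub_eq_sub_iff_add_eq_add, h, add_comm]
      rw [e, AddChar.sub_apply', hnear]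
      have h1 := hφ a ha
      have h2 := hψ a ha
      have h3 : ‖(ψ a : ℂ) - φ a‖ ≤ ‖(ψ a : ℂ) - 1‖ + ‖(φ a : ℂ) - 1‖ := by
        have := norm_sub_le ((ψ a : ℂ) - 1) ((φ a : ℂ) - 1)
        simpa using this
      have : δ ≤ ε / 2 := min_le_left _ _
      linarith
    subst hxy
    simpa using h
  have hmaps : (fun p : AddChar G Circle × AddChar G Circle => p.1 + p.2) '' (H ×ˢ bohr A δ) ⊆
      bohr B (1 / 2) := by
    rintro _ ⟨⟨x, φ⟩, ⟨hx, hφ⟩, rfl⟩ b hb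
    have h1 := hH hx b hb
    have h2 := hφ b (hBA hb)
    have e : (((x + φ) b : Circle) : ℂ) - 1 = (x b : ℂ) * ((φ b : ℂ) - 1) + ((x b : ℂ) - 1) := by
      rw [AddChar.add_apply, Circle.coe_mul]; ring
    rw [e]
    refine (norm_add_le _ _).trans_lt ?_
    rw [norm_mul, Circle.norm_coe, one_mul]
    have : δ ≤ 1 / 4 := min_le_right _ _
    linarith
  have hcount : H.ncard * (bohr A δ).ncard ≤ (bohr B (1 / 2)).ncard := by
    rw [← Set.ncard_prod, ← hinj.ncard_image]
    exact Set.ncard_le_ncard hmaps (Set.toFinite _)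
  have hcount' : (H.ncard : ℝ) * (bohr A δ).ncard ≤ (bohr B (1 / 2)).ncard := by
    exact_mod_cast hcount
  have hG : (0 : ℝ) < Nat.card G := by exact_mod_cast Nat.card_pos
  have h5 : (H.ncard : ℝ) * Nat.card G ≤ (4 * C * L) * Nat.card G := by
    calc (H.ncard : ℝ) * Nat.card G
        ≤ H.ncard * (C * ((bohr A δ).ncard * A.ncard)) := by gcongr
      _ ≤ H.ncard * (C * ((bohr A δ).ncard * (L * B.ncard))) := by gcongr
      _ = (C * L) * ((H.ncard * (bohr A δ).ncard) * B.ncard) := by ring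
      _ ≤ (C * L) * ((bohr B (1 / 2)).ncard * B.ncard) := by gcongr
      _ ≤ (C * L) * (4 * Nat.card G) := by gcongr
      _ = _ := by ring
  exact le_of_mul_le_mul_right h5 hG

end FiniteDual

namespace NonstandardUniverse

variable {U : NonstandardUniverse.{v}}

/-! ### Transfer -/

section Transfer

variable {I : Type} {F F₁ F₂ F₃ : I → Type} {ν : U.star I}

namespace Fiber

/-- The nonstandard extension of the standard predicate `P` holds at the internal element `x`. -/
def Holds (P : ∀ i, F i → Prop) (x : U.Fiber F ν) : Prop :=
  x.1 ∈ U.starSet {p : Σ i, F i | P p.1 p.2}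

theorem holds_map (P : ∀ i, F₁ i → Prop) (f : ∀ i, F i → F₁ i) (x : U.Fiber F ν) :
    Holds P (map f x) ↔ Holds (fun i a => P i (f i a)) x :=
  U.map_mem_iff _ _ _

theorem Holds.mono {P Q : ∀ i, F i → Prop} {x : U.Fiber F ν} (hx : Holds P x)
    (h : ∀ i a, P i a → Q i a) : Holds Q x :=
  U.mem_mono (fun p hp => h p.1 p.2 hp) hx

theorem holds_congr {P Q : ∀ i, F i → Prop} (x : U.Fiber F ν) (h : ∀ i a, P i a ↔ Q i a) :
    Holds P x ↔ Holds Q x :=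
  ⟨fun hx => hx.mono fun i a => (h i a).mp, fun hx => hx.mono fun i a => (h i a).mpr⟩

theorem holds_of_forall {P : ∀ i, F i → Prop} (x : U.Fiber F ν) (h : ∀ i a, P i a) : Holds P x :=
  U.mem_mono (fun p _ => h p.1 p.2) (U.mem_univ x.1)

theorem holds_not {P : ∀ i, F i → Prop} {x : U.Fiber F ν} :
    Holds (fun i a => ¬ P i a) x ↔ ¬ Holds P x :=
  U.mem_compl _ _

theorem holds_and {P Q : ∀ i, F i → Prop} {x : U.Fiber F ν} :
    Holds (fun i a => P i a ∧ Q i a) x ↔ Holds P x ∧ Holds Q x :=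
  U.mem_inter _ _ _

theorem Holds.and {P Q : ∀ i, F i → Prop} {x : U.Fiber F ν} (hP : Holds P x) (hQ : Holds Q x) :
    Holds (fun i a => P i a ∧ Q i a) x :=
  holds_and.mpr ⟨hP, hQ⟩

theorem holds_or {P Q : ∀ i, F i → Prop} {x : U.Fiber F ν} :
    Holds (fun i a => P i a ∨ Q i a) x ↔ Holds P x ∨ Holds Q x := by
  rw [← not_iff_not, not_or, ← holds_not, ← holds_not, ← holds_not, ← holds_and]
  exact holds_congr x fun i a => not_or

theorem not_holds_false (x : U.Fiber F ν) : ¬ Holds (fun _ _ => False) x :=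
  U.not_mem_empty x.1

theorem map_eq_map_iff (f g : ∀ i, F i → F₁ i) (x : U.Fiber F ν) :
    map f x = map g x ↔ Holds (fun i a => f i a = g i a) x := by
  refine Subtype.ext_iff.trans ((U.map_eq_map_iff _ _ _).trans (holds_congr
    (P := fun i a => (⟨i, f i a⟩ : Σ i, F₁ i) = ⟨i, g i a⟩) x fun i a => ?_))
  simp

theorem holds_exists_fin {n : ℕ} {P : Fin n → ∀ i, F i → Prop} {x : U.Fiber F ν} :
    Holds (fun i a => ∃ k, P k i a) x ↔ ∃ k, Holds (P k) x := by
  induction n with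
  | zero => simpa using not_holds_false x
  | succ n ih =>
    rw [Fin.exists_fin_succ, ← ih, ← holds_or]
    exact holds_congr x fun i a => Fin.exists_fin_succ

/-- Transfer of an existential quantifier: the witness is an internal element. -/
theorem holds_exists {R : ∀ i, F i → F₁ i → Prop} {x : U.Fiber F ν} :
    Holds (fun i a => ∃ b, R i a b) x ↔
      ∃ y : U.Fiber F₁ ν, Holds (fun i p => R i p.1 p.2) (joint x y) := by
  constructor
  · intro h
    obtain ⟨z, hz⟩ := U.exists_subtype h
    -- a standard choice function provides the witness
    obtain ⟨W, hW, rfl⟩ : ∃ W : U.Fiber (fun i => F i × F₁ i) ν,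
        Holds (fun i p => R i p.1 p.2) W ∧ x = map (fun _ p => p.1) W := by
      let r : {p : Σ i, F i | ∃ b, R p.1 p.2 b} → Σ i, F i × F₁ i :=
        fun p => ⟨p.1.1, p.1.2, p.2.choose⟩
      refine ⟨⟨U.map r z, ?_⟩, ?_, Subtype.ext ?_⟩
      · rw [← U.map_comp, ← x.2, ← hz, ← U.map_comp]
        rfl
      · refine (U.map_mem_iff _ _ _).mpr (U.mem_mono ?_ (U.mem_univ z))
        rintro ⟨⟨i, a⟩, ha⟩ -
        exact ha.choose_spec
      · refine hz.symm.trans (Eq.trans ?_ (U.map_comp _ _ _))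
        exact U.map_congr (fun _ => rfl) _
    refine ⟨map (fun _ p => p.2) W, ?_⟩
    rw [joint_map, holds_map]
    exact hW
  · rintro ⟨y, h⟩
    rw [← fst_joint x y, holds_map]
    exact h.mono fun i p hp => ⟨p.2, hp⟩

theorem holds_forall {R : ∀ i, F i → F₁ i → Prop} {x : U.Fiber F ν} :
    Holds (fun i a => ∀ b, R i a b) x ↔
      ∀ y : U.Fiber F₁ ν, Holds (fun i p => R i p.1 p.2) (joint x y) := by
  rw [← not_iff_not, ← holds_not, holds_congr x fun i a => not_forall, holds_exists, not_forall]
  exact exists_congr fun y => holds_not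

theorem map_sub [∀ i, AddCommGroup (F₁ i)] (f g : ∀ i, F i → F₁ i) (x : U.Fiber F ν) :
    map f x - map g x = map (fun i a => f i a - g i a) x := by
  rw [sub_eq_add_neg, neg_def, map_map, add_def, map₂_map]
  simp only [sub_eq_add_neg]

theorem map_add [∀ i, AddCommGroup (F₁ i)] (f g : ∀ i, F i → F₁ i) (x : U.Fiber F ν) :
    map f x + map g x = map (fun i a => f i a + g i a) x :=
  map₂_map _ _ _ _

theorem map_zero [∀ i, AddCommGroup (F₁ i)] (x : U.Fiber F ν) :
    map (fun i _ => (0 : F₁ i)) x = 0 := by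
  rw [map_const, zero_def]

end Fiber

open NonstandardUniverse.Fiber

namespace InternalSet

theorem mem_toSet_map {x : ∀ i, F i → F₁ i} {S : ∀ i, F i → Set (F₁ i)} {z : U.Fiber F ν} :
    Fiber.map x z ∈ toSet (Fiber.map S z) ↔ Holds (fun i a => x i a ∈ S i a) z := by
  change Holds (fun i (p : F₁ i × Set (F₁ i)) => p.1 ∈ p.2)
    (joint (Fiber.map x z) (Fiber.map S z)) ↔ _
  rw [joint_map, holds_map]

/-- Internal definition: the internal set of all `x` that satisfy the standard relation `R` with the
internal parameter `y`. -/
def sep (R : ∀ i, F i → F₁ i → Prop) (y : U.Fiber F₁ ν) : U.InternalSet F ν :=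
  Fiber.map (fun i b => {a | R i a b}) y

theorem mem_sep {R : ∀ i, F i → F₁ i → Prop} {y : U.Fiber F₁ ν} {x : U.Fiber F ν} :
    x ∈ (sep R y).toSet ↔ Holds (fun i p => R i p.1 p.2) (joint x y) := by
  obtain ⟨w, rfl, rfl⟩ := exists_joint x y
  rw [sep, map_map, mem_toSet_map, joint_map, holds_map]
  rfl

theorem holds_forall_mem {S : ∀ i, F i → Set (F₁ i)} {R : ∀ i, F i → F₁ i → Prop}
    {z : U.Fiber F ν} :
    Holds (fun i a => ∀ b ∈ S i a, R i a b) z ↔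
      ∀ y ∈ toSet (Fiber.map S z), Holds (fun i p => R i p.1 p.2) (joint z y) := by
  rw [holds_forall]
  refine forall_congr' fun y => ?_
  obtain ⟨w, rfl, rfl⟩ := exists_joint z y
  rw [map_map, mem_toSet_map, joint_map, holds_map, holds_map, imp_iff_not_or, ← holds_not,
    ← holds_or]
  exact holds_congr w fun i a => imp_iff_not_or

theorem toSet_subset_iff {S T : U.InternalSet F ν} :
    S.toSet ⊆ T.toSet ↔ Holds (fun _ p => p.1 ⊆ p.2) (joint S T) := by
  obtain ⟨w, rfl, rfl⟩ := exists_joint S T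
  rw [joint_map, holds_map]
  refine Iff.trans ?_ (holds_forall_mem (S := fun i (p : Set (F i) × Set (F i)) => p.1)
    (R := fun _ p a => a ∈ p.2)).symm
  refine forall₂_congr fun y _ => ?_
  obtain ⟨v, rfl, rfl⟩ := exists_joint w y
  rw [map_map, mem_toSet_map, joint_map, holds_map]

theorem isHyperfinite_of_finite [∀ i, Finite (F i)] (S : U.InternalSet F ν) : S.IsHyperfinite :=
  holds_of_forall (F := fun i => Set (F i)) (P := fun _ A => A.Finite) S fun _ A => Set.toFinite A

/-- An internal set with externally finitely many elements has a standard number of elements. -/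
theorem exists_ncard_le [∀ i, Finite (F i)] {S : U.InternalSet F ν} (h : S.toSet.Finite) :
    ∃ n : ℕ, Holds (fun _ A => A.ncard ≤ n) S := by
  by_contra! hcon
  obtain ⟨n, hn⟩ : ∃ n, n = S.toSet.ncard := ⟨_, rfl⟩
  -- `n + 1` internally distinct elements give `n + 1` elements of the external set
  have h1 : Holds (fun i A => ∃ f : Fin (n + 1) → F i, Function.Injective f ∧ ∀ k, f k ∈ A) S := by
    refine (holds_not.mpr (hcon n)).mono fun i A hA => ?_
    obtain ⟨B, hBA, hB⟩ := Set.exists_subset_card_eq (Nat.succ_le_of_lt (not_le.mp hA))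
    have hBf : B.Finite := Set.toFinite B
    have e : Nat.card B = n + 1 := hB
    obtain ⟨g⟩ : Nonempty (B ≃ Fin (n + 1)) := ⟨Finite.equivFinOfCardEq e⟩
    exact ⟨fun k => (g.symm k).1, Subtype.val_injective.comp g.symm.injective,
      fun k => hBA (g.symm k).2⟩
  obtain ⟨f, hf⟩ := holds_exists.mp h1
  obtain ⟨w, rfl, rfl⟩ := exists_joint S f
  rw [joint_map, holds_map] at hf
  let g : Fin (n + 1) → U.Fiber F ν := fun k => Fiber.map (fun i p => p.2 k) w
  have hginj : Function.Injective g := by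
    intro k l hkl
    by_contra hne
    refine not_holds_false w ((hf.and ((Fiber.map_eq_map_iff _ _ _).mp hkl)).mono ?_)
    rintro i p ⟨⟨hinj, -⟩, he⟩
    exact hne (hinj he)
  have hgmem : Set.range g ⊆ toSet (Fiber.map (fun _ p => p.1) w) := by
    rintro _ ⟨k, rfl⟩
    exact mem_toSet_map.mpr (hf.mono fun i p hp => hp.2 k)
  have hcard := Set.ncard_le_ncard hgmem h
  rw [← Set.image_univ, Set.ncard_image_of_injective _ hginj, Set.ncard_univ, Nat.card_fin] at hcard
  omega

/-- An internal set with a standard number of elements is externally finite. -/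
theorem finite_of_ncard_le [∀ i, Finite (F i)] [∀ i, Nonempty (F i)] {S : U.InternalSet F ν}
    {n : ℕ} (h : Holds (fun _ A => A.ncard ≤ n) S) : S.toSet.Finite := by
  have h1 : Holds (fun i A => ∃ f : Fin n → F i, ∀ a ∈ A, ∃ k, a = f k) S := by
    refine h.mono fun i A hA => ?_
    have e : Nat.card A ≤ n := hA
    obtain ⟨g⟩ : Nonempty (A ≃ Fin (Nat.card A)) := ⟨Finite.equivFin A⟩
    refine ⟨fun k => if hk : k.1 < Nat.card A then (g.symm ⟨k.1, hk⟩).1 else Classical.arbitrary _,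
      fun a ha => ⟨⟨(g ⟨a, ha⟩).1, (g ⟨a, ha⟩).2.trans_le e⟩,
      ((dif_pos (g ⟨a, ha⟩).2).trans (congrArg Subtype.val (g.symm_apply_apply ⟨a, ha⟩))).symm⟩⟩
  obtain ⟨f, hf⟩ := holds_exists.mp h1
  refine (Set.finite_range fun k : Fin n => Fiber.map (fun i (g : Fin n → F i) => g k) f).subset ?_
  intro x hx
  obtain ⟨w, rfl, rfl⟩ := exists_joint S f
  obtain ⟨v, rfl, rfl⟩ := exists_joint w x
  rw [map_map, mem_toSet_map] at hx
  rw [map_map, map_map, joint_map, holds_map] at hf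
  obtain ⟨k, hk⟩ := holds_exists_fin.mp ((hf.and hx).mono
    (Q := fun i p => ∃ k, p.1.2 k = p.2) fun i p hp => by
      obtain ⟨k, hk⟩ := hp.1 _ hp.2
      exact ⟨k, hk.symm⟩)
  refine ⟨k, ?_⟩
  simp only [map_map]
  exact (Fiber.map_eq_map_iff _ _ _).mpr hk

end InternalSet

end Transfer

/-! ### Saturation and monadic and galactic sets -/

section Saturation

variable {I : Type} {F : I → Type} {ν : U.star I} {κ : Cardinal.{v}}

/-- Saturation for downward directed families of internal sets. -/
theorem IsSaturated.exists_mem_of_directed (hU : U.IsSaturated κ) {J : Type v} [Nonempty J]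
    (hJ : Cardinal.mk J < κ) (S : J → U.InternalSet F ν)
    (hdir : Directed (fun A B => B ⊆ A) fun j => (S j).toSet)
    (hne : ∀ j, (S j).toSet.Nonempty) : ∃ x, ∀ j, x ∈ (S j).toSet := by
  obtain ⟨x, hx⟩ := hU I F ν (Set.range fun j => (S j).toSet)
    (Cardinal.mk_range_le.trans_lt hJ) (by rintro _ ⟨j, rfl⟩; exact ⟨S j, rfl⟩) (by
      intro 𝒯 h𝒯 hfin
      obtain ⟨j, hj⟩ : ∃ j, ∀ T ∈ 𝒯, (S j).toSet ⊆ T := by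
        induction 𝒯, hfin using Set.Finite.induction_on with
        | empty => exact ⟨Classical.arbitrary J, by simp⟩
        | @insert T 𝒯 _ _ ih =>
          obtain ⟨j, hj⟩ := ih ((Set.subset_insert _ _).trans h𝒯)
          obtain ⟨k, rfl⟩ := h𝒯 (Set.mem_insert _ _)
          obtain ⟨l, hlj, hlk⟩ := hdir j k
          refine ⟨l, ?_⟩
          rintro T' (rfl | hT')
          · exact hlk
          · exact hlj.trans (hj T' hT')
      obtain ⟨x, hx⟩ := hne j
      exact ⟨x, fun T hT => hj T hT hx⟩)
  exact ⟨x, fun j => hx _ ⟨j, rfl⟩⟩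

theorem mk_finset_lt (hκ : Cardinal.aleph0 < κ) {J : Type v} (hJ : Cardinal.mk J < κ) :
    Cardinal.mk (Finset J) < κ := by
  rcases finite_or_infinite J with h | h
  · exact (Cardinal.lt_aleph0_of_finite _).trans hκ
  · rwa [Cardinal.mk_finset_of_infinite]

theorem mk_prod_lt (hκ : Cardinal.aleph0 < κ) {J K : Type v} (hJ : Cardinal.mk J < κ)
    (hK : Cardinal.mk K < κ) : Cardinal.mk (J × K) < κ := by
  rw [← Cardinal.mul_def]
  exact Cardinal.mul_lt_of_lt hκ.le hJ hK

theorem mk_ulift_nat_lt (hκ : Cardinal.aleph0 < κ) : Cardinal.mk (ULift.{v} ℕ) < κ := by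
  simpa using hκ

/-- The finite intersections of internal sets are internal. -/
theorem exists_toSet_eq_biInter {J : Type*} (S : J → U.InternalSet F ν) (t : Finset J) :
    ∃ T : U.InternalSet F ν, T.toSet = ⋂ j ∈ t, (S j).toSet := by
  classical
  induction t using Finset.induction_on with
  | empty =>
    refine ⟨Fiber.const ν fun _ => Set.univ, ?_⟩
    ext x
    rw [← Fiber.map_const (F₁ := fun i => Set (F i)) (fun _ => Set.univ) x]
    have h := InternalSet.mem_toSet_map (x := fun _ a => a) (S := fun i _ => (Set.univ : Set (F i)))
      (z := x)
    rw [Fiber.map_id] at h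
    simpa using h.mpr (Fiber.holds_of_forall x fun _ _ => trivial)
  | insert j t _ ih =>
    obtain ⟨T, hT⟩ := ih
    refine ⟨InternalSet.sep (fun _ a p => a ∈ p.1 ∧ a ∈ p.2) (Fiber.joint (S j) T), ?_⟩
    ext x
    rw [InternalSet.mem_sep, Fiber.holds_and, Finset.set_biInter_insert, ← hT, Set.mem_inter_iff]
    obtain ⟨w, hw1, hw2⟩ := Fiber.exists_joint (S j) T
    rw [← hw1, ← hw2, Fiber.joint_map]
    obtain ⟨z, rfl, rfl⟩ := Fiber.exists_joint x w
    simp only [Fiber.map_map, InternalSet.mem_toSet_map, Fiber.joint_map, Fiber.holds_map]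

/-- The finite unions of internal sets are internal. -/
theorem exists_toSet_eq_biUnion {J : Type*} (S : J → U.InternalSet F ν) (t : Finset J) :
    ∃ T : U.InternalSet F ν, T.toSet = ⋃ j ∈ t, (S j).toSet := by
  obtain ⟨T, hT⟩ := exists_toSet_eq_biInter (fun j => Fiber.map (fun _ A => Aᶜ) (S j)) t
  have hc : ∀ S : U.InternalSet F ν, InternalSet.toSet (Fiber.map (fun _ A => Aᶜ) S) =
      S.toSetᶜ := by
    intro S
    ext x
    obtain ⟨z, rfl, rfl⟩ := Fiber.exists_joint x S
    rw [Fiber.map_map, InternalSet.mem_toSet_map, Set.mem_compl_iff, InternalSet.mem_toSet_map,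
      ← Fiber.holds_not]
    rfl
  refine ⟨Fiber.map (fun _ A => Aᶜ) T, ?_⟩
  rw [hc, hT]
  simp [hc]

/-- A monadic set is the intersection of a downward directed family of fewer than `κ` internal
sets. -/
theorem IsMonadic.exists_directed (hκ : Cardinal.aleph0 < κ) {A : Set (U.Fiber F ν)}
    (hA : IsMonadic κ A) :
    ∃ (J : Type v) (S : J → U.InternalSet F ν), Nonempty J ∧ Cardinal.mk J < κ ∧
      Directed (fun A B => B ⊆ A) (fun j => (S j).toSet) ∧ A = ⋂ j, (S j).toSet := by
  classical
  obtain ⟨𝒬, hcard, hint, rfl⟩ := hA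
  choose T hT using hint
  choose S hS using exists_toSet_eq_biInter fun Q : 𝒬 => T Q.1 Q.2
  refine ⟨Finset 𝒬, S, inferInstance, mk_finset_lt hκ hcard, fun s t => ⟨s ∪ t, ?_, ?_⟩, ?_⟩
  · simp only [hS]
    exact Set.biInter_subset_biInter_left fun _ h => Finset.mem_union_left _ h
  · simp only [hS]
    exact Set.biInter_subset_biInter_left fun _ h => Finset.mem_union_right _ h
  · ext x
    simp only [hS, Set.mem_sInter, Set.mem_iInter]
    constructor
    · intro h t Q _
      rw [hT Q Q.2]
      exact h Q Q.2
    · intro h Q hQ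
      have := h {⟨Q, hQ⟩} ⟨Q, hQ⟩ (by simp)
      rwa [hT Q hQ] at this

/-- A galactic set is the union of an upward directed family of fewer than `κ` internal sets. -/
theorem IsGalactic.exists_directed (hκ : Cardinal.aleph0 < κ) {A : Set (U.Fiber F ν)}
    (hA : IsGalactic κ A) :
    ∃ (J : Type v) (S : J → U.InternalSet F ν), Nonempty J ∧ Cardinal.mk J < κ ∧
      Directed (fun A B => A ⊆ B) (fun j => (S j).toSet) ∧ A = ⋃ j, (S j).toSet := by
  classical
  obtain ⟨𝒬, hcard, hint, rfl⟩ := hA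
  choose T hT using hint
  choose S hS using exists_toSet_eq_biUnion fun Q : 𝒬 => T Q.1 Q.2
  refine ⟨Finset 𝒬, S, inferInstance, mk_finset_lt hκ hcard, fun s t => ⟨s ∪ t, ?_, ?_⟩, ?_⟩
  · simp only [hS]
    exact Set.biUnion_subset_biUnion_left fun _ h => Finset.mem_union_left _ h
  · simp only [hS]
    exact Set.biUnion_subset_biUnion_left fun _ h => Finset.mem_union_right _ h
  · ext x
    simp only [hS, Set.mem_sUnion, Set.mem_iUnion]
    constructor
    · rintro ⟨Q, hQ, hx⟩
      refine ⟨{⟨Q, hQ⟩}, ⟨Q, hQ⟩, by simp, ?_⟩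
      rwa [hT Q hQ]
    · rintro ⟨t, Q, _, hx⟩
      rw [hT Q Q.2] at hx
      exact ⟨Q, Q.2, hx⟩

theorem isMonadic_iInter {J : Type v} (hJ : Cardinal.mk J < κ) (S : J → U.InternalSet F ν) :
    IsMonadic κ (⋂ j, (S j).toSet) :=
  ⟨Set.range fun j => (S j).toSet, Cardinal.mk_range_le.trans_lt hJ,
    by rintro _ ⟨j, rfl⟩; exact ⟨S j, rfl⟩, (Set.sInter_range _).symm⟩

theorem isGalactic_iUnion {J : Type v} (hJ : Cardinal.mk J < κ) (S : J → U.InternalSet F ν) :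
    IsGalactic κ (⋃ j, (S j).toSet) :=
  ⟨Set.range fun j => (S j).toSet, Cardinal.mk_range_le.trans_lt hJ,
    by rintro _ ⟨j, rfl⟩; exact ⟨S j, rfl⟩, (Set.sUnion_range _).symm⟩

end Saturation

/-! ### Hyperreal arithmetic -/

section Arithmetic

theorem eq_of_map_fst_of_map_snd {A B : Type} {x y : U.star (A × B)}
    (h₁ : U.map Prod.fst x = U.map Prod.fst y) (h₂ : U.map Prod.snd x = U.map Prod.snd y) :
    x = y := by
  obtain ⟨c, rfl, rfl⟩ := U.pair x y
  rw [← U.map_comp, ← U.map_comp, U.map_eq_map_iff] at h₁ h₂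
  rw [U.map_eq_map_iff]
  refine U.mem_mono ?_ ((U.mem_inter _ _ _).mpr ⟨h₁, h₂⟩)
  rintro p ⟨hp₁, hp₂⟩
  exact Prod.ext hp₁ hp₂

theorem mkPair_map {A B C : Type} (f : A → B) (g : A → C) (c : U.star A) :
    mkPair (U.map f c) (U.map g c) = U.map (fun a => (f a, g a)) c := by
  have h := Classical.choose_spec (U.pair (U.map f c) (U.map g c))
  apply eq_of_map_fst_of_map_snd
  · rw [← U.map_comp]
    exact h.1
  · rw [← U.map_comp]
    exact h.2

theorem map_mul_map {A : Type} (f g : A → ℝ) (c : U.star A) :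
    U.map f c * U.map g c = U.map (fun a => f a * g a) c := by
  change U.map (fun p : ℝ × ℝ => p.1 * p.2) (mkPair _ _) = _
  rw [mkPair_map, ← U.map_comp]
  rfl

theorem map_inv' {A : Type} (f : A → ℝ) (c : U.star A) :
    (U.map f c)⁻¹ = U.map (fun a => (f a)⁻¹) c :=
  (U.map_comp _ _ _).symm

theorem isFinite_map {A : Type} {f : A → ℝ} {c : U.star A} :
    IsFinite (U.map f c) ↔ ∃ M : ℝ, c ∈ U.starSet {a | |f a| ≤ M} :=
  exists_congr fun _ => U.map_mem_iff _ _ _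

theorem not_isInfinitesimal_map {A : Type} {f : A → ℝ} {c : U.star A} :
    ¬ IsInfinitesimal (U.map f c) ↔ ∃ ε : ℝ, 0 < ε ∧ c ∈ U.starSet {a | ε ≤ |f a|} := by
  rw [IsInfinitesimal]
  push Not
  refine exists_congr fun ε => and_congr_right fun _ => ?_
  rw [← U.mem_compl, U.map_mem_iff]
  have e : f ⁻¹' {r : ℝ | |r| < ε}ᶜ = {a | ε ≤ |f a|} := by
    ext a
    simp
  rw [e]

theorem isPos_map {A : Type} {f : A → ℝ} {c : U.star A} :
    IsPos (U.map f c) ↔ c ∈ U.starSet {a | 0 < f a} :=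
  U.map_mem_iff _ _ _

end Arithmetic

/-! ### Internal Bohr sets -/

section BohrSets

open NonstandardUniverse.Fiber NonstandardUniverse.InternalSet FiniteDual

variable {I : Type} {F F₁ F₂ : I → Type} {ν : U.star I}

theorem Fiber.exists_eq_joint (z : U.Fiber (fun i => F i × F₁ i) ν) :
    ∃ (x : U.Fiber F ν) (y : U.Fiber F₁ ν), z = joint x y :=
  ⟨Fiber.map (fun _ p => p.1) z, Fiber.map (fun _ p => p.2) z, by
    rw [joint_map]; exact (Fiber.map_id z).symm⟩

theorem Fiber.exists_joint₃ (x : U.Fiber F ν) (y : U.Fiber F₁ ν) (z : U.Fiber F₂ ν) :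
    ∃ w : U.Fiber (fun i => F i × F₁ i × F₂ i) ν, Fiber.map (fun _ p => p.1) w = x ∧
      Fiber.map (fun _ p => p.2.1) w = y ∧ Fiber.map (fun _ p => p.2.2) w = z := by
  obtain ⟨w, hx, h⟩ := exists_joint x (joint y z)
  refine ⟨w, hx, ?_, ?_⟩
  · rw [← fst_joint y z, ← h, map_map]
  · rw [← snd_joint y z, ← h, map_map]

theorem InternalSet.exists_toSet_eq_union (S T : U.InternalSet F ν) :
    ∃ W : U.InternalSet F ν, W.toSet = S.toSet ∪ T.toSet := by
  obtain ⟨w, rfl, rfl⟩ := exists_joint S T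
  refine ⟨Fiber.map (fun _ p => p.1 ∪ p.2) w, ?_⟩
  ext x
  obtain ⟨v, rfl, rfl⟩ := exists_joint w x
  simp only [Set.mem_union, map_map, mem_toSet_map, holds_or]

theorem InternalSet.exists_toSet_eq_inter (S T : U.InternalSet F ν) :
    ∃ W : U.InternalSet F ν, W.toSet = S.toSet ∩ T.toSet := by
  obtain ⟨w, rfl, rfl⟩ := exists_joint S T
  refine ⟨Fiber.map (fun _ p => p.1 ∩ p.2) w, ?_⟩
  ext x
  obtain ⟨v, rfl, rfl⟩ := exists_joint w x
  simp only [Set.mem_inter_iff, map_map, mem_toSet_map, holds_and]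

theorem InternalSet.exists_toSet_eq_diff (S T : U.InternalSet F ν) :
    ∃ W : U.InternalSet F ν, W.toSet = S.toSet \ T.toSet := by
  obtain ⟨w, rfl, rfl⟩ := exists_joint S T
  refine ⟨Fiber.map (fun _ p => p.1 \ p.2) w, ?_⟩
  ext x
  obtain ⟨v, rfl, rfl⟩ := exists_joint w x
  simp only [Set.mem_sdiff, map_map, mem_toSet_map, holds_and, holds_not]

theorem InternalSet.exists_toSet_eq_singleton (x : U.Fiber F ν) :
    ∃ W : U.InternalSet F ν, W.toSet = {x} := by
  refine ⟨Fiber.map (fun _ a => {a}) x, ?_⟩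
  ext y
  obtain ⟨v, rfl, rfl⟩ := exists_joint x y
  rw [map_map, mem_toSet_map, Set.mem_singleton_iff, Fiber.map_eq_map_iff]
  rfl

variable {G : I → Type} [∀ i, AddCommGroup (G i)]

/-- The value of the internal character `γ` at `a` is at distance less than `ε` from `1`. -/
def IsNear (ε : ℝ) (γ : U.Fiber (DualFamily G) ν) (a : U.Fiber G ν) : Prop :=
  Holds (fun i (p : DualFamily G i × G i) => ‖(p.1 p.2 : ℂ) - 1‖ < ε) (joint γ a)

theorem mem_infAnnihilator {A : Set (U.Fiber G ν)} {γ : U.Fiber (DualFamily G) ν} :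
    γ ∈ infAnnihilator A ↔ ∀ a ∈ A, ∀ ε : ℝ, 0 < ε → IsNear ε γ a :=
  forall₂_congr fun _ _ => forall₂_congr fun _ _ => U.map_mem_iff _ _ _

/-- The internal Bohr set of an internal set, with standard radius. -/
def bohrSet (A : U.InternalSet G ν) (ε : ℝ) : U.InternalSet (DualFamily G) ν :=
  Fiber.map (fun _ S => bohr S ε) A

theorem mem_bohrSet {A : U.InternalSet G ν} {ε : ℝ} {γ : U.Fiber (DualFamily G) ν} :
    γ ∈ (bohrSet A ε).toSet ↔ ∀ a ∈ A.toSet, IsNear ε γ a := by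
  obtain ⟨w, rfl, rfl⟩ := exists_joint A γ
  rw [bohrSet, map_map, mem_toSet_map]
  refine Iff.trans (holds_forall_mem (S := fun i (p : Set (G i) × DualFamily G i) => p.1)
    (R := fun _ p a => ‖(p.2 a : ℂ) - 1‖ < ε)) (forall₂_congr fun y _ => ?_)
  obtain ⟨v, rfl, rfl⟩ := exists_joint w y
  rw [IsNear, map_map, joint_map, joint_map, holds_map, holds_map]

theorem IsNear.mono {ε δ : ℝ} (h : ε ≤ δ) {γ : U.Fiber (DualFamily G) ν} {a : U.Fiber G ν}
    (hγ : IsNear ε γ a) : IsNear δ γ a :=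
  Holds.mono hγ fun _ _ hp => hp.trans_le h

theorem bohrSet_subset {A B : U.InternalSet G ν} {ε δ : ℝ} (hBA : B.toSet ⊆ A.toSet) (h : ε ≤ δ) :
    (bohrSet A ε).toSet ⊆ (bohrSet B δ).toSet := fun _ hγ =>
  mem_bohrSet.mpr fun b hb => (mem_bohrSet.mp hγ b (hBA hb)).mono h

/-- The infinitesimal annihilator of a galactic set is the intersection of a directed family of
Bohr sets. -/
theorem IsGalactic.infAnnihilator_eq_iInter {κ : Cardinal.{v}} (hκ : Cardinal.aleph0 < κ)
    {A : Set (U.Fiber G ν)} (hA : IsGalactic κ A) :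
    ∃ (J : Type v) (S : J → U.InternalSet G ν) (ε : J → ℝ), Nonempty J ∧ Cardinal.mk J < κ ∧
      (∀ j, (S j).toSet ⊆ A) ∧ (∀ j, 0 < ε j) ∧
      Directed (fun A B => B ⊆ A) (fun j => (bohrSet (S j) (ε j)).toSet) ∧
      (infAnnihilator A : Set (U.Fiber (DualFamily G) ν)) =
        ⋂ j, (bohrSet (S j) (ε j)).toSet := by
  obtain ⟨J, S, hJ, hJκ, hdir, rfl⟩ := hA.exists_directed hκ
  refine ⟨J × ULift.{v} ℕ, fun p => S p.1, fun p => 1 / ((p.2.down : ℝ) + 1), inferInstance,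
    mk_prod_lt hκ hJκ (mk_ulift_nat_lt hκ), fun p => Set.subset_iUnion (fun j => (S j).toSet) p.1,
    fun p => by positivity, ?_, ?_⟩
  · rintro ⟨j, ⟨m⟩⟩ ⟨k, ⟨n⟩⟩
    obtain ⟨l, hj, hk⟩ := hdir j k
    refine ⟨⟨l, ⟨max m n⟩⟩, bohrSet_subset hj ?_, bohrSet_subset hk ?_⟩
    · exact one_div_le_one_div_of_le (by positivity) (by simp)
    · exact one_div_le_one_div_of_le (by positivity) (by simp)
  · ext γ
    simp only [SetLike.mem_coe, mem_infAnnihilator, Set.mem_iInter, mem_bohrSet, Set.mem_iUnion,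
      Prod.forall, ULift.forall]
    constructor
    · intro h j n a ha
      exact h a ⟨j, ha⟩ _ (by positivity)
    · rintro h a ⟨j, ha⟩ ε hε
      obtain ⟨n, hn⟩ := exists_nat_one_div_lt hε
      exact (h j n a ha).mono hn.le

end BohrSets

/-! ### Internal cardinalities -/

section Cardinality

open NonstandardUniverse.Fiber

variable {I : Type} {F F₁ G : I → Type} {ν : U.star I}

theorem card_map (S : ∀ i, F i → Set (F₁ i)) (w : U.Fiber F ν) :
    InternalSet.card (Fiber.map S w) = U.map (fun p => ((S p.1 p.2).ncard : ℝ)) w.1 := by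
  rw [InternalSet.card, Fiber.map, ← U.map_comp]
  rfl

theorem fiberCard_eq (w : U.Fiber F ν) :
    fiberCard G ν = U.map (fun p : Σ i, F i => (Nat.card (G p.1) : ℝ)) w.1 := by
  rw [fiberCard]
  conv_lhs => rw [← w.2]
  rw [← U.map_comp]
  rfl

theorem inv_inv_card_mul (D : U.InternalSet G ν) :
    (D.card⁻¹ * fiberCard G ν)⁻¹ = D.card * (fiberCard G ν)⁻¹ := by
  rw [fiberCard_eq D, InternalSet.card, map_inv', map_inv', map_mul_map, map_mul_map, map_inv']
  refine U.map_congr (fun p => ?_) _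
  rw [mul_inv, inv_inv]

end Cardinality

section Dual

open NonstandardUniverse.Fiber NonstandardUniverse.InternalSet FiniteDual

variable {I : Type} {G : I → Type} [∀ i, AddCommGroup (G i)] {ν : U.star I}
  {κ : Cardinal.{v}} {G₀ Gf : AddSubgroup (U.Fiber G ν)}

/-! ### Consequences of saturation -/

/-- There are internal sets between `G₀` and `Gf`: already some member of a directed family of
internal sets with intersection `G₀` lies in `Gf`. -/
theorem IsIMGTriplet.exists_isBetween (hκ : Cardinal.aleph0 < κ) (hU : U.IsSaturated κ)
    (hG : IsIMGTriplet κ G₀ Gf) : ∃ D : U.InternalSet G ν, IsBetween G₀ Gf D := by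
  obtain ⟨J, Q, hJ, hJκ, hQdir, hQ⟩ := hG.monadic.exists_directed hκ
  obtain ⟨K, R, hK, hKκ, hRdir, hR⟩ := hG.galactic.exists_directed hκ
  choose S hS using fun p : J × K => exists_toSet_eq_diff (Q p.1) (R p.2)
  by_contra! hcon
  obtain ⟨x, hx⟩ := hU.exists_mem_of_directed (mk_prod_lt hκ hJκ hKκ) S (by
    rintro ⟨j, k⟩ ⟨j', k'⟩
    obtain ⟨l, hl, hl'⟩ := hQdir j j'
    obtain ⟨m, hm, hm'⟩ := hRdir k k'
    refine ⟨(l, m), ?_, ?_⟩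
    · simp only [hS]
      exact Set.sdiff_subset_sdiff hl hm
    · simp only [hS]
      exact Set.sdiff_subset_sdiff hl' hm') (by
    rintro ⟨j, k⟩
    rw [hS]
    by_contra hne
    rw [Set.not_nonempty_iff_eq_empty, Set.sdiff_eq_empty] at hne
    refine hcon (Q j) ⟨hQ ▸ Set.iInter_subset _ j, hne.trans ?_⟩
    rw [hR]
    exact Set.subset_iUnion (fun k => (R k).toSet) k)
  have h0 : x ∈ (G₀ : Set (U.Fiber G ν)) := by
    rw [hQ, Set.mem_iInter]
    intro j
    have := hx (j, Classical.arbitrary K)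
    rw [hS] at this
    exact this.1
  have hf : x ∈ (Gf : Set (U.Fiber G ν)) := hG.le h0
  rw [hR, Set.mem_iUnion] at hf
  obtain ⟨k, hk⟩ := hf
  have := hx (Classical.arbitrary J, k)
  rw [hS] at this
  exact this.2 hk

/-- A set between `G₀` and `Gf` can be enlarged by any internal subset of `Gf`. -/
theorem IsBetween.union {A D : U.InternalSet G ν} (hD : IsBetween G₀ Gf D)
    (hA : A.toSet ⊆ Gf) :
    ∃ A' : U.InternalSet G ν, IsBetween G₀ Gf A' ∧ A.toSet ⊆ A'.toSet ∧ D.toSet ⊆ A'.toSet := by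
  obtain ⟨A', hA'⟩ := exists_toSet_eq_union A D
  refine ⟨A', ⟨?_, ?_⟩, ?_, ?_⟩
  · rw [hA']
    exact hD.1.trans Set.subset_union_right
  · rw [hA']
    exact Set.union_subset hA hD.2
  · rw [hA']
    exact Set.subset_union_left
  · rw [hA']
    exact Set.subset_union_right

/-- An internal set of characters that annihilate the monadic set `⋂ j, Q j` is uniformly near to
`1` on one of the sets `Q j`. -/
theorem exists_subset_bohrSet_of_directed (hU : U.IsSaturated κ) {J : Type v} [Nonempty J]
    (hJ : Cardinal.mk J < κ) (Q : J → U.InternalSet G ν)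
    (hQ : Directed (fun A B => B ⊆ A) fun j => (Q j).toSet) {E : U.InternalSet (DualFamily G) ν}
    (hE : E.toSet ⊆ infAnnihilator (⋂ j, (Q j).toSet)) {ε : ℝ} (hε : 0 < ε) :
    ∃ j, E.toSet ⊆ (bohrSet (Q j) ε).toSet := by
  have hS : ∀ Q : U.InternalSet G ν, ∃ S : U.InternalSet (fun i => DualFamily G i × G i) ν,
      ∀ γ a, joint γ a ∈ S.toSet ↔ γ ∈ E.toSet ∧ a ∈ Q.toSet ∧ ¬ IsNear ε γ a := by
    intro Q
    refine ⟨sep (fun i q p => q.1 ∈ p.1 ∧ q.2 ∈ p.2 ∧ ¬ ‖(q.1 q.2 : ℂ) - 1‖ < ε) (joint E Q),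
      fun γ a => ?_⟩
    rw [mem_sep]
    obtain ⟨w, rfl, rfl⟩ := exists_joint E Q
    obtain ⟨v, rfl, rfl, rfl⟩ := exists_joint₃ γ a w
    simp only [IsNear, map_map, joint_map, holds_map, mem_toSet_map, holds_and, holds_not]
  choose S hS using fun j => hS (Q j)
  by_contra! hcon
  obtain ⟨x, hx⟩ := hU.exists_mem_of_directed hJ S (by
    intro j k
    obtain ⟨l, hl, hl'⟩ := hQ j k
    refine ⟨l, fun x hx => ?_, fun x hx => ?_⟩
    all_goals
      obtain ⟨y, z, rfl⟩ := exists_eq_joint x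
      replace hx := (hS l y z).mp hx
    · exact (hS j y z).mpr ⟨hx.1, hl hx.2.1, hx.2.2⟩
    · exact (hS k y z).mpr ⟨hx.1, hl' hx.2.1, hx.2.2⟩) (by
    intro j
    obtain ⟨γ, hγ, hγj⟩ := Set.not_subset.mp (hcon j)
    rw [mem_bohrSet] at hγj
    push Not at hγj
    obtain ⟨a, ha, hna⟩ := hγj
    exact ⟨joint γ a, (hS j γ a).mpr ⟨hγ, ha, hna⟩⟩)
  obtain ⟨γ, a, rfl⟩ := exists_eq_joint x
  simp only [hS] at hx
  have j₀ := Classical.arbitrary J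
  refine (hx j₀).2.2 (mem_infAnnihilator.mp (hE (hx j₀).1) a ?_ ε hε)
  exact Set.mem_iInter.mpr fun j => (hx j).2.1

/-- An internal set of characters that annihilate `G₀` lies in a Bohr set over an internal set
between `G₀` and `Gf`. -/
theorem IsIMGTriplet.exists_subset_bohrSet (hκ : Cardinal.aleph0 < κ) (hU : U.IsSaturated κ)
    (hG : IsIMGTriplet κ G₀ Gf) {E : U.InternalSet (DualFamily G) ν}
    (hE : E.toSet ⊆ infAnnihilator (G₀ : Set (U.Fiber G ν))) {ε : ℝ} (hε : 0 < ε) :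
    ∃ B : U.InternalSet G ν, IsBetween G₀ Gf B ∧ E.toSet ⊆ (bohrSet B ε).toSet := by
  obtain ⟨D, hD⟩ := hG.exists_isBetween hκ hU
  obtain ⟨J, Q, hJ, hJκ, hQdir, hQ⟩ := hG.monadic.exists_directed hκ
  rw [hQ] at hE
  obtain ⟨j, hj⟩ := exists_subset_bohrSet_of_directed hU hJκ Q hQdir hE hε
  obtain ⟨B, hB⟩ := exists_toSet_eq_inter (Q j) D
  refine ⟨B, ⟨?_, ?_⟩, hj.trans (bohrSet_subset ?_ le_rfl)⟩
  · rw [hB]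
    refine Set.subset_inter ?_ hD.1
    rw [hQ]
    exact Set.iInter_subset _ j
  · rw [hB]
    exact Set.inter_subset_right.trans hD.2
  · rw [hB]
    exact Set.inter_subset_left

/-- An internal set that contains the infinitesimal annihilator of a galactic set contains a Bohr
set over an internal subset. -/
theorem IsGalactic.exists_bohrSet_subset (hκ : Cardinal.aleph0 < κ) (hU : U.IsSaturated κ)
    {A : Set (U.Fiber G ν)} (hA : IsGalactic κ A) {E : U.InternalSet (DualFamily G) ν}
    (hE : (infAnnihilator A : Set (U.Fiber (DualFamily G) ν)) ⊆ E.toSet) :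
    ∃ (S : U.InternalSet G ν) (ε : ℝ), S.toSet ⊆ A ∧ 0 < ε ∧ (bohrSet S ε).toSet ⊆ E.toSet := by
  obtain ⟨J, S, ε, hJ, hJκ, hSA, hε, hdir, hann⟩ := hA.infAnnihilator_eq_iInter hκ
  by_contra! hcon
  choose T hT using fun j => exists_toSet_eq_diff (bohrSet (S j) (ε j)) E
  obtain ⟨γ, hγ⟩ := hU.exists_mem_of_directed hJκ T (by
    intro j k
    obtain ⟨l, hl, hl'⟩ := hdir j k
    refine ⟨l, ?_, ?_⟩
    · simp only [hT]
      exact Set.sdiff_subset_sdiff_left hl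
    · simp only [hT]
      exact Set.sdiff_subset_sdiff_left hl') (by
    intro j
    rw [hT]
    exact Set.sdiff_nonempty.mpr (hcon (S j) (ε j) (hSA j) (hε j)))
  simp only [hT] at hγ
  refine (hγ (Classical.arbitrary J)).2 (hE ?_)
  rw [hann]
  exact Set.mem_iInter.mpr fun j => (hγ j).1

/-- An internal set of characters that are pairwise incongruent modulo the infinitesimal annihilator
of a galactic set is separated by a Bohr set over an internal subset. -/
theorem IsGalactic.exists_separated (hκ : Cardinal.aleph0 < κ) (hU : U.IsSaturated κ)
    {A : Set (U.Fiber G ν)} (hA : IsGalactic κ A) {H : U.InternalSet (DualFamily G) ν}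
    (hH : ∀ x ∈ H.toSet, ∀ y ∈ H.toSet, x ≠ y → x - y ∉ infAnnihilator A) :
    ∃ (S : U.InternalSet G ν) (ε : ℝ), S.toSet ⊆ A ∧ 0 < ε ∧
      ∀ x ∈ H.toSet, ∀ y ∈ H.toSet, x ≠ y → x - y ∉ (bohrSet S ε).toSet := by
  obtain ⟨J, S, ε, hJ, hJκ, hSA, hε, hdir, hann⟩ := hA.infAnnihilator_eq_iInter hκ
  have hT : ∀ B : U.InternalSet (DualFamily G) ν,
      ∃ T : U.InternalSet (fun i => DualFamily G i × DualFamily G i) ν, ∀ x y,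
        joint x y ∈ T.toSet ↔ x ∈ H.toSet ∧ y ∈ H.toSet ∧ x ≠ y ∧ x - y ∈ B.toSet := by
    intro B
    refine ⟨sep (fun i q p => q.1 ∈ p.1 ∧ q.2 ∈ p.1 ∧ ¬ q.1 = q.2 ∧ q.1 - q.2 ∈ p.2) (joint H B),
      fun x y => ?_⟩
    rw [mem_sep]
    obtain ⟨w, rfl, rfl⟩ := exists_joint H B
    obtain ⟨v, rfl, rfl, rfl⟩ := exists_joint₃ x y w
    simp only [map_map, joint_map, holds_map, mem_toSet_map, holds_and, holds_not, ne_eq,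
      Fiber.map_eq_map_iff, Fiber.map_sub]
  choose T hT using fun j => hT (bohrSet (S j) (ε j))
  by_contra! hcon
  obtain ⟨z, hz⟩ := hU.exists_mem_of_directed hJκ T (by
    intro j k
    obtain ⟨l, hl, hl'⟩ := hdir j k
    refine ⟨l, fun x hx => ?_, fun x hx => ?_⟩
    all_goals
      obtain ⟨y, z, rfl⟩ := exists_eq_joint x
      replace hx := (hT l y z).mp hx
    · exact (hT j y z).mpr ⟨hx.1, hx.2.1, hx.2.2.1, hl hx.2.2.2⟩
    · exact (hT k y z).mpr ⟨hx.1, hx.2.1, hx.2.2.1, hl' hx.2.2.2⟩) (by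
    intro j
    obtain ⟨x, hx, y, hy, hxy, h⟩ := hcon (S j) (ε j) (hSA j) (hε j)
    exact ⟨joint x y, (hT j x y).mpr ⟨hx, hy, hxy, h⟩⟩)
  obtain ⟨x, y, rfl⟩ := exists_eq_joint z
  simp only [hT] at hz
  obtain ⟨hx, hy, hxy, -⟩ := hz (Classical.arbitrary J)
  refine hH x hx y hy hxy ?_
  rw [← SetLike.mem_coe, hann]
  exact Set.mem_iInter.mpr fun j => (hz j).2.2.2

/-! ### Coverings in a condensing triplet -/

section Covering

theorem holds_zero_mem {B : U.InternalSet G ν} (hB : (0 : U.Fiber G ν) ∈ B.toSet) :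
    Holds (fun _ S => 0 ∈ S) B := by
  rw [← map_zero B] at hB
  have h := mem_toSet_map (x := fun i (_ : Set (G i)) => (0 : G i)) (S := fun _ S => S) (z := B)
  rw [Fiber.map_id] at h
  exact h.mp hB

variable [∀ i, Finite (G i)]

/-- A maximal internal set of elements of `A` that are pairwise separated by `B` is finite in a
condensing triplet, and its translates of `B` cover `A`. -/
theorem IsCondensingTriplet.exists_coveredBy (hG : IsCondensingTriplet κ G₀ Gf)
    {A B : U.InternalSet G ν} (hA : A.toSet ⊆ Gf) (hB : (G₀ : Set (U.Fiber G ν)) ⊆ B.toSet) :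
    ∃ n : ℕ, Holds (fun _ p => CoveredBy n p.1 p.2) (joint A B) := by
  have h0 := holds_zero_mem (hB G₀.zero_mem)
  have hex : Holds (fun i (p : Set (G i) × Set (G i)) => ∃ H : Set (G i), H ⊆ p.1 ∧
      (∀ x ∈ H, ∀ y ∈ H, x ≠ y → x - y ∈ p.2 → y - x ∉ p.2) ∧
      ∀ a ∈ p.1, ∃ h ∈ H, a - h ∈ p.2) (joint A B) := by
    rw [← snd_joint A B, holds_map] at h0
    exact h0.mono fun i p hp => exists_separated_cover p.1 p.2 hp
  obtain ⟨H, hH⟩ := holds_exists.mp hex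
  obtain ⟨w, rfl, rfl, rfl⟩ := exists_joint₃ A B H
  rw [joint_map, joint_map, holds_map] at hH
  have hfin : (toSet (Fiber.map (fun _ p => p.2.2) w)).Finite := by
    by_contra hinf
    obtain ⟨x, hx, y, hy, hxy, hxy0⟩ := hG.condensing _ (isHyperfinite_of_finite _)
      (Set.Subset.trans (toSet_subset_iff.mpr (by
        rw [joint_map, holds_map]
        exact hH.mono fun i p hp => hp.1)) hA) hinf
    have hyx0 : y - x ∈ G₀ := by simpa using G₀.neg_mem hxy0
    have h1 := hB hxy0
    have h2 := hB hyx0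
    obtain ⟨v, rfl, rfl, rfl⟩ := exists_joint₃ x y w
    rw [Fiber.map_sub, map_map, mem_toSet_map] at h1 h2
    rw [map_map, mem_toSet_map] at hx hy
    rw [holds_map] at hH
    rw [ne_eq, Fiber.map_eq_map_iff, ← holds_not] at hxy
    refine not_holds_false v (((hH.and (hx.and hy)).and (hxy.and (h1.and h2))).mono ?_)
    rintro i p ⟨⟨hp, hpx, hpy⟩, hne, hp1, hp2⟩
    exact hp.2.1 _ hpx _ hpy hne hp1 hp2
  obtain ⟨n, hn⟩ := exists_ncard_le hfin
  rw [holds_map] at hn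
  refine ⟨n, ?_⟩
  rw [joint_map, holds_map]
  exact (hH.and hn).mono fun i p hp => ⟨p.2.2, Set.toFinite _, hp.2, hp.1.2.2⟩

/-- The internal sets between `G₀` and `Gf` have standard doubling. -/
theorem IsCondensingTriplet.exists_doubling (hG : IsCondensingTriplet κ G₀ Gf)
    {A : U.InternalSet G ν} (hA : IsBetween G₀ Gf A) :
    ∃ K : ℕ, Holds (fun _ S => CoveredBy K {x | ∃ a ∈ S, ∃ b ∈ S, a + b = x} S) A := by
  have hsum : toSet (Fiber.map (fun i (S : Set (G i)) => {x | ∃ a ∈ S, ∃ b ∈ S, a + b = x}) A) ⊆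
      Gf := by
    intro x hx
    obtain ⟨w, rfl, rfl⟩ := exists_joint x A
    rw [map_map, mem_toSet_map] at hx
    obtain ⟨a, ha⟩ := holds_exists.mp
      (hx.mono (Q := fun i (p : G i × Set (G i)) => ∃ a : G i, a ∈ p.2 ∧ ∃ b ∈ p.2, a + b = p.1)
        fun i p hp => hp)
    obtain ⟨v, rfl, rfl⟩ := exists_joint w a
    rw [joint_map, holds_map] at ha
    obtain ⟨b, hb⟩ := holds_exists.mp (ha.mono
      (Q := fun i p => ∃ b : G i, p.2 ∈ p.1.2 ∧ b ∈ p.1.2 ∧ p.2 + b = p.1.1)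
      fun i p hp => by
        obtain ⟨h1, b, h2, h3⟩ := hp
        exact ⟨b, h1, h2, h3⟩)
    obtain ⟨u, rfl, rfl⟩ := exists_joint v b
    rw [joint_map, holds_map, holds_and, holds_and] at hb
    obtain ⟨h1, h2, h3⟩ := hb
    have h1' := hA.2 (by simpa only [map_map] using mem_toSet_map.mpr h1)
    have h2' := hA.2 (by simpa only [map_map] using mem_toSet_map.mpr h2)
    have h3' := (Fiber.map_eq_map_iff _ _ _).mpr h3
    rw [← Fiber.map_add] at h3'
    simp only [map_map]
    rw [← h3']
    exact Gf.add_mem h1' h2'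
  obtain ⟨K, hK⟩ := hG.exists_coveredBy hsum hA.1
  refine ⟨K, ?_⟩
  have e := joint_map (fun i (S : Set (G i)) => {x | ∃ a ∈ S, ∃ b ∈ S, a + b = x})
    (fun _ S => S) A
  rw [Fiber.map_id] at e
  rw [e, holds_map] at hK
  exact hK

end Covering

/-! ### The dual triplet -/

section DualTriplet

theorem holds_separated {H : U.InternalSet (DualFamily G) ν} {A : U.InternalSet G ν} {ε : ℝ}
    (h : ∀ x ∈ H.toSet, ∀ y ∈ H.toSet, x ≠ y → x - y ∉ (bohrSet A ε).toSet) :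
    Holds (fun i (p : Set (DualFamily G i) × Set (G i)) =>
      ∀ x ∈ p.1, ∀ y ∈ p.1, x ≠ y → x - y ∉ bohr p.2 ε) (joint H A) := by
  by_contra hcon
  have h1 : Holds (fun i (p : Set (DualFamily G i) × Set (G i)) =>
      ∃ q : DualFamily G i × DualFamily G i, q.1 ∈ p.1 ∧ q.2 ∈ p.1 ∧ ¬ q.1 = q.2 ∧ q.1 - q.2 ∈ bohr p.2 ε)
      (joint H A) := by
    refine (holds_not.mpr hcon).mono fun i p hp => ?_
    push Not at hp
    obtain ⟨x, hx, y, hy, hxy, hb⟩ := hp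
    exact ⟨(x, y), hx, hy, hxy, hb⟩
  obtain ⟨q, hq⟩ := holds_exists.mp h1
  obtain ⟨w, rfl, rfl, rfl⟩ := exists_joint₃ H A q
  rw [joint_map, joint_map, holds_map, holds_and, holds_and, holds_and, holds_not] at hq
  obtain ⟨hx, hy, hxy, hb⟩ := hq
  refine h _ (mem_toSet_map.mpr hx) _ (mem_toSet_map.mpr hy)
    (fun e => hxy ((Fiber.map_eq_map_iff _ _ _).mp e)) ?_
  rw [bohrSet, map_map, Fiber.map_sub]
  exact mem_toSet_map.mpr hb

/-- If `z ^ 2 ^ m` is at distance less than `1 / 4` from `1` for all `m ≤ n`, then `z` is very near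
to `1`: each of these squarings multiplies the distance from `1` by at least `3 / 2`. -/
theorem norm_sub_one_le_of_pow (z : Circle) (n : ℕ)
    (h : ∀ m ≤ n, ‖((z ^ 2 ^ m : Circle) : ℂ) - 1‖ < 1 / 4) :
    ‖(z : ℂ) - 1‖ ≤ (1 / 4) * (2 / 3) ^ n := by
  induction n generalizing z with
  | zero => simpa using (h 0 le_rfl).le
  | succ n ih =>
    have h0 : ‖(z : ℂ) - 1‖ < 1 / 4 := by simpa using h 0 (Nat.zero_le _)
    have h1 := ih (z ^ 2) fun m hm => by
      have := h (m + 1) (by omega)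
      rwa [pow_succ', pow_mul] at this
    have h2 : ((z ^ 2 : Circle) : ℂ) - 1 = ((z : ℂ) - 1) * (2 + ((z : ℂ) - 1)) := by
      rw [Circle.coe_pow]; ring
    rw [h2, norm_mul] at h1
    have h3 : (3 / 2 : ℝ) ≤ ‖2 + ((z : ℂ) - 1)‖ := by
      have := norm_sub_le (2 + ((z : ℂ) - 1)) ((z : ℂ) - 1)
      rw [add_sub_cancel_right, Complex.norm_ofNat] at this
      linarith
    rw [pow_succ]
    nlinarith [norm_nonneg ((z : ℂ) - 1)]

/-- A character that is near to `1` on a subgroup, within the fixed distance `1 / 4`, is infinitely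
near to `1` there. -/
theorem mem_infAnnihilator_of_isNear {γ : U.Fiber (DualFamily G) ν}
    (h : ∀ a ∈ G₀, IsNear (1 / 4) γ a) : γ ∈ infAnnihilator (G₀ : Set (U.Fiber G ν)) := by
  rw [mem_infAnnihilator]
  intro a ha ε hε
  obtain ⟨n, hn⟩ := exists_pow_lt_of_lt_one hε (show (2 / 3 : ℝ) < 1 by norm_num)
  have hmul : ∀ m : ℕ, Fiber.map (fun i (x : G i) => (2 ^ m) • x) a ∈ G₀ := by
    intro m
    induction m with
    | zero => simpa using (Fiber.map_id a).symm ▸ ha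
    | succ m ih =>
      have := G₀.add_mem ih ih
      rw [Fiber.map_add] at this
      simpa only [pow_succ, mul_two, add_smul] using this
  have hpow : ∀ m : ℕ, Holds (fun i (p : DualFamily G i × G i) =>
      ‖((p.1 p.2 ^ 2 ^ m : Circle) : ℂ) - 1‖ < 1 / 4) (joint γ a) := by
    intro m
    have h1 := h _ (hmul m)
    obtain ⟨w, rfl, rfl⟩ := exists_joint γ a
    rw [IsNear, map_map, joint_map, holds_map] at h1
    rw [joint_map, holds_map]
    exact h1.mono fun i p hp => by rwa [AddChar.map_nsmul_eq_pow] at hp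
  have hall : ∀ k : ℕ, Holds (fun i (p : DualFamily G i × G i) => ∀ m ≤ k,
      ‖((p.1 p.2 ^ 2 ^ m : Circle) : ℂ) - 1‖ < 1 / 4) (joint γ a) := by
    intro k
    induction k with
    | zero =>
      refine (hpow 0).mono fun i p hp m hm => ?_
      rwa [Nat.le_zero.mp hm]
    | succ k ih =>
      refine (ih.and (hpow (k + 1))).mono fun i p hp m hm => ?_
      rcases Nat.le_succ_iff.mp hm with h' | rfl
      · exact hp.1 m h'
      · exact hp.2
  refine (hall n).mono fun i p hp => (norm_sub_one_le_of_pow _ n hp).trans_lt ?_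
  have : (0 : ℝ) < (2 / 3) ^ n := by positivity
  linarith

/-- The dual triplet is an IMG triplet. By saturation, the annihilator of `G₀` is the union of the
Bohr sets of the fixed radius `1 / 4` over a directed family of internal sets with intersection `G₀`. -/
theorem IsIMGTriplet.dual (hκ : Cardinal.aleph0 < κ) (hU : U.IsSaturated κ)
    (hG : IsIMGTriplet κ G₀ Gf) :
    IsIMGTriplet κ (infAnnihilator (Gf : Set (U.Fiber G ν)))
      (infAnnihilator (G₀ : Set (U.Fiber G ν))) where
  le γ hγ := mem_infAnnihilator.mpr fun a ha => mem_infAnnihilator.mp hγ a (hG.le ha)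
  monadic := by
    obtain ⟨J, S, ε, -, hJκ, -, -, -, hann⟩ := hG.galactic.infAnnihilator_eq_iInter hκ
    rw [hann]
    exact isMonadic_iInter hJκ _
  galactic := by
    obtain ⟨J, Q, hJ, hJκ, hQdir, hQ⟩ := hG.monadic.exists_directed hκ
    have e : (infAnnihilator (G₀ : Set (U.Fiber G ν)) : Set (U.Fiber (DualFamily G) ν)) =
        ⋃ j, (bohrSet (Q j) (1 / 4)).toSet := by
      ext γ
      rw [SetLike.mem_coe, Set.mem_iUnion]
      constructor
      · intro hγ
        obtain ⟨E, hE⟩ := exists_toSet_eq_singleton γ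
        obtain ⟨j, hj⟩ := exists_subset_bohrSet_of_directed hU hJκ Q hQdir (E := E)
          (by rw [hE, ← hQ]; exact Set.singleton_subset_iff.mpr hγ) (ε := 1 / 4) (by norm_num)
        exact ⟨j, hj (by rw [hE]; rfl)⟩
      · rintro ⟨j, hj⟩
        refine mem_infAnnihilator_of_isNear fun a ha => mem_bohrSet.mp hj a ?_
        rw [← SetLike.mem_coe, hQ] at ha
        exact Set.mem_iInter.mp ha j
    rw [e]
    exact isGalactic_iUnion hJκ _

variable [∀ i, Finite (G i)]

/-- The dual triplet of a condensing triplet is condensing: a set of characters in the annihilator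
of `G₀` that are pairwise incongruent modulo the annihilator of `Gf` is separated by a Bohr set, so it
has a standard number of elements by the counting of separated characters in finite groups. -/
theorem IsCondensingTriplet.dual (hκ : Cardinal.aleph0 < κ) (hU : U.IsSaturated κ)
    (hG : IsCondensingTriplet κ G₀ Gf) :
    IsCondensingTriplet κ (infAnnihilator (Gf : Set (U.Fiber G ν)))
      (infAnnihilator (G₀ : Set (U.Fiber G ν))) where
  toIsIMGTriplet := hG.toIsIMGTriplet.dual hκ hU
  condensing H _ hH hinf := by
    by_contra! hcon
    obtain ⟨B, hB, hHB⟩ := hG.exists_subset_bohrSet hκ hU hH (ε := 1 / 4) (by norm_num)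
    obtain ⟨S, ε, hS, hε, hsep⟩ := hG.galactic.exists_separated hκ hU hcon
    obtain ⟨A, hA, hSA, hBA⟩ := hB.union hS
    have hsepA := holds_separated (A := A) fun x hx y hy hxy h =>
      hsep x hx y hy hxy (bohrSet_subset hSA le_rfl h)
    have h0 := holds_zero_mem (hA.1 G₀.zero_mem)
    obtain ⟨K, hK⟩ := hG.exists_doubling hA
    obtain ⟨L, hL⟩ := hG.exists_coveredBy hA.2 hB.1
    obtain ⟨N, hN⟩ := exists_ncard_separated_le.{0} K L hε
    refine hinf (finite_of_ncard_le (n := N) ?_)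
    rw [toSet_subset_iff] at hHB hBA
    obtain ⟨w, rfl, rfl, rfl⟩ := exists_joint₃ H A B
    rw [bohrSet, map_map, joint_map, holds_map] at hHB
    rw [joint_map, holds_map] at hsepA hBA hL
    rw [holds_map] at hK h0 ⊢
    refine ((h0.and (hBA.and hK)).and (hL.and (hHB.and hsepA))).mono ?_
    rintro i p ⟨⟨h0, hBA, hK⟩, hL, hHB, hsep⟩
    exact hN p.2.1 p.2.2 p.1 h0 hBA hK hL hHB hsep

/-! ### Normalizing multipliers -/

theorem IsCondensingTriplet.isNormalizingMultiplier_inv_card (hG : IsCondensingTriplet κ G₀ Gf)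
    {D : U.InternalSet G ν} (hD : IsBetween G₀ Gf D) : IsNormalizingMultiplier G₀ Gf D.card⁻¹ := by
  have h0 := holds_zero_mem (hD.1 G₀.zero_mem)
  have hcard : ∀ {i : I} {S : Set (G i)}, 0 ∈ S → (0 : ℝ) < S.ncard := fun h => by
    exact_mod_cast (Set.ncard_pos (Set.toFinite _)).mpr ⟨_, h⟩
  refine ⟨?_, fun A hA => ?_⟩
  · rw [InternalSet.card, map_inv', isPos_map]
    exact h0.mono fun i S hS => inv_pos.mpr (hcard hS)
  · have h0A := holds_zero_mem (hA.1 G₀.zero_mem)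
    obtain ⟨m, hm⟩ := hG.exists_coveredBy hA.2 hD.1
    obtain ⟨n, hn⟩ := hG.exists_coveredBy hD.2 hA.1
    obtain ⟨w, rfl, rfl⟩ := exists_joint A D
    rw [joint_map, holds_map] at hm hn
    rw [holds_map] at h0 h0A
    rw [card_map, card_map, map_inv', map_mul_map, isFinite_map, not_isInfinitesimal_map]
    refine ⟨⟨m, U.mem_mono ?_ (h0.and (h0A.and hm))⟩, 1 / (n + 1), by positivity,
      U.mem_mono ?_ (h0.and (h0A.and hn))⟩
    · rintro ⟨i, p⟩ ⟨hp0, hpA, hp⟩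
      have h1 : (p.1.ncard : ℝ) ≤ m * p.2.ncard := by exact_mod_cast hp.ncard_le
      have h2 := hcard hp0
      rw [Set.mem_ofPred_eq, abs_of_nonneg (by positivity), inv_mul_le_iff₀ h2]
      linarith
    · rintro ⟨i, p⟩ ⟨hp0, hpA, hp⟩
      have h1 : (p.2.ncard : ℝ) ≤ n * p.1.ncard := by exact_mod_cast hp.ncard_le
      have h2 := hcard hp0
      have h3 := hcard hpA
      rw [Set.mem_ofPred_eq, abs_of_nonneg (by positivity), inv_mul_eq_div,
        div_le_div_iff₀ (by positivity) h2]
      nlinarith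

/-- The product `(d |G|)⁻¹ |E|` is finite because `E` lies in a Bohr set over some `B`, and it is
not infinitesimal because `E` contains a Bohr set over some `A`, with `A` and `B` between `G₀` and
`Gf`. -/
theorem IsCondensingTriplet.isNormalizingMultiplier_dual (hκ : Cardinal.aleph0 < κ)
    (hU : U.IsSaturated κ) (hG : IsCondensingTriplet κ G₀ Gf) {d : U.star ℝ}
    (hd : IsNormalizingMultiplier G₀ Gf d) :
    IsNormalizingMultiplier (infAnnihilator (Gf : Set (U.Fiber G ν)))
      (infAnnihilator (G₀ : Set (U.Fiber G ν))) (d * fiberCard G ν)⁻¹ := by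
  have hGpos : ∀ i, (0 : ℝ) < Nat.card (G i) := fun i => by exact_mod_cast Nat.card_pos
  refine ⟨?_, fun E hE => ?_⟩
  · obtain ⟨c, hcd, hc⟩ := U.pair d ν
    have hpos := hd.1
    rw [fiberCard, ← hcd, ← hc, ← U.map_comp, map_mul_map, map_inv', isPos_map]
    rw [← hcd, isPos_map] at hpos
    exact U.mem_mono (fun p hp => inv_pos.mpr (mul_pos hp (hGpos _))) hpos
  · obtain ⟨B, hB, hEB⟩ := hG.exists_subset_bohrSet hκ hU hE.2 (ε := 1 / 2) (by norm_num)
    obtain ⟨S, ε, hS, hε, hSE⟩ := hG.galactic.exists_bohrSet_subset hκ hU hE.1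
    obtain ⟨A, hA, hSA, -⟩ := hB.union hS
    replace hSE := (bohrSet_subset hSA le_rfl).trans hSE
    have h0 := holds_zero_mem (hA.1 G₀.zero_mem)
    obtain ⟨K, hK⟩ := hG.exists_doubling hA
    obtain ⟨C, hC0, hC⟩ := exists_ncard_bohr_lower_bound.{0} K hε
    have hfin := (hd.2 A hA).1
    have hinf := (hd.2 B hB).2
    have hpos := hd.1
    rw [toSet_subset_iff] at hEB hSE
    obtain ⟨w, rfl, rfl, rfl⟩ := exists_joint₃ E A B
    rw [bohrSet, map_map, joint_map, holds_map] at hEB hSE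
    rw [holds_map] at hK h0
    have hlow : Holds (fun i (p : Set (DualFamily G i) × Set (G i) × Set (G i)) =>
        (Nat.card (G i) : ℝ) ≤ C * (p.1.ncard * p.2.1.ncard)) w := by
      refine (h0.and (hK.and hSE)).mono ?_
      rintro i p ⟨hp0, hpK, hpE⟩
      refine (hC p.2.1 hp0 hpK).trans ?_
      have : ((bohr p.2.1 ε).ncard : ℝ) ≤ p.1.ncard := by
        exact_mod_cast Set.ncard_le_ncard hpE (Set.toFinite _)
      gcongr
    have hup : Holds (fun i (p : Set (DualFamily G i) × Set (G i) × Set (G i)) =>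
        (p.1.ncard : ℝ) * p.2.2.ncard ≤ 4 * Nat.card (G i)) w := by
      refine hEB.mono fun i p hp => le_trans ?_ (ncard_bohr_mul_le p.2.2)
      have : (p.1.ncard : ℝ) ≤ (bohr p.2.2 (1 / 2)).ncard := by
        exact_mod_cast Set.ncard_le_ncard hp (Set.toFinite _)
      gcongr
    obtain ⟨c, hcd, hcw⟩ := U.pair d w.1
    rw [Holds, ← hcw, U.map_mem_iff] at hlow hup
    rw [card_map, ← hcd, ← hcw, ← U.map_comp, map_mul_map] at hfin hinf
    rw [isFinite_map] at hfin
    rw [not_isInfinitesimal_map] at hinf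
    rw [← hcd, isPos_map] at hpos
    rw [card_map, fiberCard_eq w, ← hcd, ← hcw, ← U.map_comp, ← U.map_comp, map_mul_map, map_inv',
      map_mul_map, isFinite_map, not_isInfinitesimal_map]
    obtain ⟨M, hM⟩ := hfin
    obtain ⟨δ, hδ, hδB⟩ := hinf
    refine ⟨⟨4 / δ, U.mem_mono ?_ ((U.mem_inter _ _ _).mpr
      ⟨(U.mem_inter _ _ _).mpr ⟨hpos, hup⟩, hδB⟩)⟩, 1 / (C * (|M| + 1)), by positivity,
      U.mem_mono ?_ ((U.mem_inter _ _ _).mpr ⟨(U.mem_inter _ _ _).mpr ⟨hpos, hlow⟩, hM⟩)⟩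
    · rintro ⟨r, i, e, a, b⟩ ⟨⟨hr, hu⟩, hb⟩
      simp only [Set.mem_ofPred_eq, Set.mem_preimage, Function.comp_apply] at hr hu hb ⊢
      have hg := hGpos i
      rw [abs_of_nonneg (by positivity)] at hb ⊢
      rw [inv_mul_eq_div, div_le_div_iff₀ (by positivity) hδ]
      calc (e.ncard : ℝ) * δ ≤ e.ncard * (r * b.ncard) := by gcongr
        _ = r * (e.ncard * b.ncard) := by ring
        _ ≤ r * (4 * Nat.card (G i)) := by gcongr
        _ = _ := by ring
    · rintro ⟨r, i, e, a, b⟩ ⟨⟨hr, hl⟩, ha⟩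
      simp only [Set.mem_ofPred_eq, Set.mem_preimage, Function.comp_apply] at hr hl ha ⊢
      have hg := hGpos i
      rw [abs_of_nonneg (by positivity)] at ha
      refine le_trans ?_ (le_abs_self _)
      have ha' : r * a.ncard ≤ |M| + 1 := by linarith [le_abs_self M]
      rw [inv_mul_eq_div, div_le_div_iff₀ (by positivity) (by positivity)]
      calc 1 * (r * (Nat.card (G i) : ℝ)) ≤ r * (C * (e.ncard * a.ncard)) := by
            rw [one_mul]; gcongr
        _ = e.ncard * (C * (r * a.ncard)) := by ring
        _ ≤ e.ncard * (C * (|M| + 1)) := by gcongr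

end DualTriplet

end Dual

end NonstandardUniverse

end

theorem theorem2p3p4 (U : NonstandardUniverse.{v}) (κ : Cardinal.{v})
    (hκ : Cardinal.aleph0 < κ) (hU : U.IsSaturated κ)
    {I : Type} (G : I → Type) [∀ i, AddCommGroup (G i)] [∀ i, Finite (G i)] (ν : U.star I)
    (G₀ Gf : AddSubgroup (U.Fiber G ν))
    (hG : NonstandardUniverse.IsCondensingTriplet κ G₀ Gf) :
    -- the dual triplet is a condensing triplet
    NonstandardUniverse.IsCondensingTriplet κ
      (NonstandardUniverse.infAnnihilator (Gf : Set (U.Fiber G ν)))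
      (NonstandardUniverse.infAnnihilator (G₀ : Set (U.Fiber G ν))) ∧
    -- the multipliers given by an internal set between `G₀` and `Gf`
    (∀ D : U.InternalSet G ν, NonstandardUniverse.IsBetween G₀ Gf D →
      NonstandardUniverse.IsNormalizingMultiplier G₀ Gf (D.card)⁻¹ ∧
      NonstandardUniverse.IsNormalizingMultiplier
        (NonstandardUniverse.infAnnihilator (Gf : Set (U.Fiber G ν)))
        (NonstandardUniverse.infAnnihilator (G₀ : Set (U.Fiber G ν)))
        (D.card * (NonstandardUniverse.fiberCard G ν)⁻¹)) ∧
    -- arbitrary normalizing multipliers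
    (∀ d : U.star ℝ, NonstandardUniverse.IsNormalizingMultiplier G₀ Gf d →
      NonstandardUniverse.IsNormalizingMultiplier
        (NonstandardUniverse.infAnnihilator (Gf : Set (U.Fiber G ν)))
        (NonstandardUniverse.infAnnihilator (G₀ : Set (U.Fiber G ν)))
        (d * NonstandardUniverse.fiberCard G ν)⁻¹) := by
  refine ⟨hG.dual hκ hU, fun D hD => ⟨hG.isNormalizingMultiplier_inv_card hD, ?_⟩,
    fun d hd => hG.isNormalizingMultiplier_dual hκ hU hd⟩
  rw [← NonstandardUniverse.inv_inv_card_mul]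
  exact hG.isNormalizingMultiplier_dual hκ hU (hG.isNormalizingMultiplier_inv_card hD)
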